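/- Let $M$ be a smooth ($C^\infty$, Hausdorff, finite-dimensional, without boundary) manifold, let $X$ be a smooth vector field on $M$ and $\mathcal V\subset TM$ a smooth distribution of rank $m$. Put $\mathcal D=\mathcal V+[X,\mathcal V]$ and assume that $(X,\mathcal V)$ is a regular dynamic pair, that is, $X(x)\ne0$ for all $x$, $\operatorname{rk}\mathcal D=2m$ and $[X,\mathcal D]\subset\mathcal D$. No metric is assumed. If $\hat V=(V_1,\dots,V_m)$ is a local frame of $\mathcal V$, then $[X,[X,\hat V]]=\hat V H_0+[X,\hat V]H_1$ for unique matrices of smooth functions $H_0,H_1$, and the matrix $-H_0+\tfrac12X(H_1)-\tfrac14H_1^2$ represents in this frame the curvature operator $K_x:\mathcal V(x)\to\mathcal V(x)$, which does not depend on the frame. A local section $Y$ of $\mathcal V$ is normal if $[X,[X,Y]]\in\mathcal V$; the horizontal space $\mathcal H(x)$ is spanned by the vectors $[X,Y](x)$ with $Y$ normal near $x$. One has $\mathcal D=\mathcal V\oplus\mathcal H$, and $D_XW=\pi_{\mathcal V}[X,W]$ for sections $W$ of $\mathcal V$, also for sections along an integral curve of $X$ (the bracket being computed with a local extension of $W$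 to a section of $\mathcal V$). Let $T>0$ and let $c:[0,T]\to M$ be an integral curve of $X$. A time $t^*\in(0,T]$ is a conjugate time along $c$ if $\exp(t^*X)_*\mathcal V(c(0))\cap\mathcal V(c(t^*))\neq\{0\}$, and the dimension of this intersection is its multiplicity. Let $\ell_1(t),\dots,\ell_r(t)\subset\mathcal V(c(t))$, $t\in[0,T]$, be one-dimensional subspaces that are linearly independent for every $t$, such that each $\ell_i$ is parallel with respect to $D_X$ along $c$ (spanned by a nowhere vanishing section $W_i$ of $\mathcal V$ along $c$ with $D_XW_i=0$) and invariant under the curvature, with eigenvalue $\lambda_i(t)$: $K_{c(t)}v=\lambda_i(t)v$ for $v\in\ell_i(t)$, $t\in[0,T]$. Then: (i) If, for some $i$ and some constant $\kappa>0$, $\lambda_i(t)\ge\kappa$ for all $t\in(0,T]$, and if $\pi/\sqrt\kappa\le T$, then there is a conjugate time in $(0,\pi/\sqrt\kappa\,]$. (ii) For every $i$, every zero in $(0,T]$ of a solution on $[0,T]$ of $\ddot y_i=-\lambda_i(t)y_i$ with $y_i(0)=0$, $\dot y_i(0)\neq0$ is a conjugate time along $c$. If $t^*\in(0,T]$ is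 a common zero of such solutions $y_i$ for $k$ different indices $i$, then the multiplicity of $t^*$ is at least $k$. -/

import Mathlib

open scoped Manifold ContDiff Topology Bundle

noncomputable section

namespace DynamicPair

section

variable {E : Type*} [NormedAddCommGroup E] [NormedSpace ℝ E]
  {M : Type*} [TopologicalSpace M] [ChartedSpace E M] [IsManifold 𝓘(ℝ, E) ∞ M]

/-- A (not necessarily continuous) vector field on `M`. -/
abbrev VField (E : Type*) [NormedAddCommGroup E] [NormedSpace ℝ E]
    (M : Type*) [TopologicalSpace M] [ChartedSpace E M] : Type _ :=
  (x : M) → TangentSpace 𝓘(ℝ, E) x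

/-- A field of tangent planes on `M`, i.e. a subspace of each tangent space. -/
abbrev Planes (E : Type*) [NormedAddCommGroup E] [NormedSpace ℝ E]
    (M : Type*) [TopologicalSpace M] [ChartedSpace E M] : Type _ :=
  (x : M) → Submodule ℝ (TangentSpace 𝓘(ℝ, E) x)

/-- The vector field `Y` is smooth at every point near `x`. -/
def SmoothNear (Y : VField E M) (x : M) : Prop :=
  ∀ᶠ y in 𝓝 x, ContMDiffAt 𝓘(ℝ, E) 𝓘(ℝ, E).tangent ∞
    (fun z => (⟨z, Y z⟩ : TangentBundle 𝓘(ℝ, E) M)) y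

/-- The Lie bracket `[X, Y]`. -/
abbrev ad (X Y : VField E M) : VField E M := VectorField.mlieBracket 𝓘(ℝ, E) X Y

/-- `Y` is, near `x`, a smooth section of the field of planes `V`. -/
def IsLocalSection (V : Planes E M) (Y : VField E M) (x : M) : Prop :=
  SmoothNear Y x ∧ ∀ᶠ y in 𝓝 x, Y y ∈ V y

/-- `F = (F 1, …, F m)` is, near `x`, a smooth frame of `V`. -/
def IsLocalFrame {m : ℕ} (V : Planes E M) (F : Fin m → VField E M) (x : M) : Prop :=
  (∀ i, SmoothNear (F i) x) ∧
    ∀ᶠ y in 𝓝 x, LinearIndependent ℝ (fun i => F i y) ∧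
      Submodule.span ℝ (Set.range fun i => F i y) = V y

/-- `V` is a smooth distribution of rank `m`. -/
def IsDistribution (m : ℕ) (V : Planes E M) : Prop :=
  ∀ x, ∃ F : Fin m → VField E M, IsLocalFrame V F x

/-- The field of planes `𝓓 = 𝓥 + [X, 𝓥]`. -/
def bracketPlanes (X : VField E M) (V : Planes E M) : Planes E M := fun x =>
  V x ⊔ Submodule.span ℝ {w | ∃ Y, IsLocalSection V Y x ∧ w = ad X Y x}

/-- `(X, V)` is a regular dynamic pair of rank `m` on `M`. -/
structure IsRegular (m : ℕ) (X : VField E M) (V : Planes E M) : Prop where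
  smooth : ∀ x, SmoothNear X x
  distribution : IsDistribution m V
  ne_zero : ∀ x, X x ≠ 0
  rank_eq : ∀ x, Module.finrank ℝ (bracketPlanes X V x) = 2 * m
  invariant : ∀ x Y, IsLocalSection (bracketPlanes X V) Y x → ad X Y x ∈ bracketPlanes X V x

/-- `K` is the value at `x` of the curvature matrix of `(X, V)` in the frame `F`:
`K = -H₀ + X(H₁)/2 - H₁²/4`, where `[X, [X, F]] = F H₀ + [X, F] H₁` near `x`. -/
def IsCurvatureMatrix {m : ℕ} (X : VField E M) (F : Fin m → VField E M) (x : M)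
    (K : Matrix (Fin m) (Fin m) ℝ) : Prop :=
  ∃ H₀ H₁ : M → Matrix (Fin m) (Fin m) ℝ,
    (∀ᶠ y in 𝓝 x, ∀ i j,
      ContMDiffAt 𝓘(ℝ, E) 𝓘(ℝ, ℝ) ∞ (fun z => H₀ z i j) y ∧
      ContMDiffAt 𝓘(ℝ, E) 𝓘(ℝ, ℝ) ∞ (fun z => H₁ z i j) y) ∧
    (∀ᶠ y in 𝓝 x, ∀ j, ad X (ad X (F j)) y =
      ∑ i, H₀ y i j • F i y + ∑ i, H₁ y i j • ad X (F i) y) ∧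
    K = -H₀ x
      + (1 / 2 : ℝ) • Matrix.of
          (fun i j => (mfderiv 𝓘(ℝ, E) 𝓘(ℝ, ℝ) (fun z => H₁ z i j) x (X x) : ℝ))
      - (1 / 4 : ℝ) • (H₁ x * H₁ x)

/-- `K_x v = w`, where `K_x : V x → V x` is the curvature operator, i.e. the operator given in a
local frame of `V` by the curvature matrix. -/
def CurvatureEq (m : ℕ) (X : VField E M) (V : Planes E M) (x : M)
    (v w : TangentSpace 𝓘(ℝ, E) x) : Prop :=
  ∃ F : Fin m → VField E M, IsLocalFrame V F x ∧
    ∃ K, IsCurvatureMatrix X F x K ∧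
      ∃ a : Fin m → ℝ, v = ∑ i, a i • F i x ∧ w = ∑ i, K.mulVec a i • F i x

/-- `Y` is, near `x`, a normal section of `V`: `[X, [X, Y]] ∈ V`. -/
def IsNormalSection (X : VField E M) (V : Planes E M) (Y : VField E M) (x : M) : Prop :=
  IsLocalSection V Y x ∧ ∀ᶠ y in 𝓝 x, ad X (ad X Y) y ∈ V y

/-- The horizontal planes: at `x`, the span of the brackets `[X, Y]`, `Y` normal near `x`. -/
def horizontal (X : VField E M) (V : Planes E M) : Planes E M := fun x =>
  Submodule.span ℝ {w | ∃ Y, IsNormalSection X V Y x ∧ w = ad X Y x}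

/-- The local section `Y` of `V` near `c t` restricts, at times of `[0, T]` near `t`, to the
section `W` along `c`. -/
def Extends (V : Planes E M) (c : ℝ → M) (T : ℝ)
    (W : (s : ℝ) → TangentSpace 𝓘(ℝ, E) (c s)) (t : ℝ) (Y : VField E M) : Prop :=
  IsLocalSection V Y (c t) ∧ ∀ᶠ s in 𝓝[Set.Icc 0 T] t, Y (c s) = W s

/-- `(D_X W)(t) = v` for a section `W` of `V` along the integral curve `c` of `X` on `[0, T]`: the
vector `v` is the `V`-component of `[X, W](c t)` in the splitting into `V` and the horizontal
plane. The bracket is computed with a local extension of `W`. -/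
def CovDerivEq (X : VField E M) (V : Planes E M) (c : ℝ → M) (T : ℝ)
    (W : (s : ℝ) → TangentSpace 𝓘(ℝ, E) (c s)) (t : ℝ) (v : TangentSpace 𝓘(ℝ, E) (c t)) : Prop :=
  v ∈ V (c t) ∧ ∃ Y, Extends V c T W t Y ∧ ad X Y (c t) - v ∈ horizontal X V (c t)

/-- `L` is a one-dimensional subspace of `V` along `c : [0, T] → M`, parallel with respect to
`D_X`: it is spanned by a nowhere vanishing section `W` of `V` with `D_X W = 0`. -/
def IsParallelLine (X : VField E M) (V : Planes E M) (c : ℝ → M) (T : ℝ)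
    (L : (t : ℝ) → Submodule ℝ (TangentSpace 𝓘(ℝ, E) (c t))) : Prop :=
  ∃ W : (t : ℝ) → TangentSpace 𝓘(ℝ, E) (c t), ∀ t ∈ Set.Icc 0 T,
    W t ≠ 0 ∧ L t = Submodule.span ℝ {W t} ∧ CovDerivEq X V c T W t 0

/-- The integral curve of `X` starting at `x` exists on `[0, t]` and ends at `y`. -/
def FlowsTo (X : VField E M) (t : ℝ) (x y : M) : Prop :=
  ∃ γ : ℝ → M, IsMIntegralCurveOn γ X (Set.Icc 0 t) ∧ γ 0 = x ∧ γ t = y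

open Classical in
/-- The time `t` map `exp(tX)` of the flow of `X`, for `0 ≤ t` (with the value `x` where the flow
is not defined). -/
def flowMap (X : VField E M) (t : ℝ) (x : M) : M :=
  if h : ∃ y, FlowsTo X t x y then h.choose else x

/-- The space `exp(tX)_* V(x₀) ∩ V(exp(tX) x₀)`; here `exp(tX) x₀ = c t` if `c` is the integral
curve of `X` with `c 0 = x₀`. -/
def conjugateSpace (X : VField E M) (V : Planes E M) (x₀ : M) (t : ℝ) :
    Submodule ℝ (TangentSpace 𝓘(ℝ, E) (flowMap X t x₀)) :=
  (V x₀).map (mfderiv 𝓘(ℝ, E) 𝓘(ℝ, E) (flowMap X t) x₀).toLinearMap ⊓ V (flowMap X t x₀)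

/-- `t` is a conjugate time along the integral curve of `X` on `[0, T]` starting at `x₀`. -/
def IsConjugateTime (X : VField E M) (V : Planes E M) (x₀ : M) (T t : ℝ) : Prop :=
  t ∈ Set.Ioc 0 T ∧ conjugateSpace X V x₀ t ≠ ⊥

/-- The multiplicity of a conjugate time. -/
def multiplicity (X : VField E M) (V : Planes E M) (x₀ : M) (t : ℝ) : ℕ :=
  Module.finrank ℝ (conjugateSpace X V x₀ t)

end

/-- `y` solves `y'' = -lam y` on `[0, T]` with `y(0) = 0` and `y'(0) ≠ 0`. -/
def IsScalarSolution (lam : ℝ → ℝ) (T : ℝ) (y : ℝ → ℝ) : Prop :=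
  ∃ y' : ℝ → ℝ,
    (∀ t ∈ Set.Icc 0 T, HasDerivWithinAt y (y' t) (Set.Icc 0 T) t ∧
      HasDerivWithinAt y' (-lam t * y t) (Set.Icc 0 T) t) ∧
    y 0 = 0 ∧ y' 0 ≠ 0

end DynamicPair

end

/-! The idea is to build Jacobi fields. Let `W` span one of the parallel lines, with eigenvalue λ.
Everything rests on the identity [X,[X,W]] = -λW along `c`. For a solution of y'' = -λy it gives,
for J = y'W - y[X,W], that [X,J] = (-λyW + y'[X,W]) - (y'[X,W] - λyW) = 0. Hence the flow of X
carries J(0) to J(t). If y(0) = y(t) = 0, this says that y'(0)W(0) goes to y'(t)W(t). Zeros of y are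
simple, so the common vector is nonzero and t is a conjugate time. Several indices give vectors in
independent lines, hence the bound on the multiplicity. For (i), Sturm comparison with sin(√κ t)
puts a zero of y in (0, π/√κ].

The identity is a computation in a frame G with [X,[X,G]] = G H₀ + [X,G] H₁. By the Leibniz rule, Y
= Ga satisfies [X,[X,Y]] = G(X²a + H₀a) + [X,G](2Xa + H₁a). By the rank condition G and [X,G] are
independent, so normality forces Xa = -H₁a/2. Horizontal vectors are therefore of the form [X,G]b -
G H₁b/2, and a parallel section satisfies Xa = -H₁a/2 along `c`
(`IsRegular.exists_eq_of_mem_horizontal`). Differentiating once more along `c` leaves [X,[X,Y]] = -G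
K a, with K the curvature matrix (`IsRegular.ad_ad_eq_neg_curvature`).

The analytic part is the differentiability of the flow: locally the derivative solves the linearised
equation (`exists_localFlow`), and compactness of the time interval globalises this
(`exists_hasMFDerivAt_flowMap_of_isLieParallel`). Continuity of λ is not assumed; it is deduced from
the identity (`IsRegular.continuousOn_eigenvalue`). -/

noncomputable section

namespace DynamicPair

/-! ### The scalar equation y'' = -qy: existence, simple zeros, Sturm comparison. -/

section ScalarEquation

open Set

/-- The Prüfer angle equation `θ' = cos² θ + q sin² θ` has a solution on `[0, T]`. -/
lemma exists_pruferAngle {q : ℝ → ℝ} (hq : Continuous q) {T : ℝ} (hT : 0 ≤ T) :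
    ∃ θ : ℝ → ℝ, θ 0 = 0 ∧ ∀ t ∈ Icc 0 T,
      HasDerivWithinAt θ (Real.cos (θ t) ^ 2 + q t * Real.sin (θ t) ^ 2) (Icc 0 T) t := by
  obtain ⟨B, hB⟩ := isCompact_Icc.exists_bound_of_continuousOn (hq.continuousOn (s := Icc 0 T))
  have hB0 : 0 ≤ B := (norm_nonneg _).trans (hB 0 ⟨le_rfl, hT⟩)
  -- The angle equation is used because its right side is bounded, here by `L`: a ball of radius `L
  -- * T` is never left, and one Picard–Lindelöf step covers all of [0, T]. The Lipschitz constant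
  -- `K` comes from |sin²x - sin²y| ≤ 2|x - y|.
  obtain ⟨L, hL⟩ : ∃ L : NNReal, (L : ℝ) = 1 + B := ⟨⟨1 + B, by positivity⟩, rfl⟩
  obtain ⟨K, hK⟩ : ∃ K : NNReal, (K : ℝ) = 2 * (1 + B) := ⟨⟨2 * (1 + B), by positivity⟩, rfl⟩
  obtain ⟨a, ha⟩ : ∃ a : NNReal, (a : ℝ) = (1 + B) * T := ⟨⟨(1 + B) * T, by positivity⟩, rfl⟩
  have key : ∀ t x : ℝ, Real.cos x ^ 2 + q t * Real.sin x ^ 2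
      = 1 + (q t - 1) * Real.sin x ^ 2 := fun t x => by rw [Real.cos_sq']; ring
  have hq1 : ∀ t ∈ Icc 0 T, |q t - 1| ≤ 1 + B := fun t ht => by
    have := abs_sub (q t) 1
    have h2 := hB t ht
    rw [Real.norm_eq_abs] at h2
    simp only [abs_one] at this
    linarith
  have hpl : IsPicardLindelof (fun t x : ℝ => Real.cos x ^ 2 + q t * Real.sin x ^ 2)
      (tmin := 0) (tmax := T) ⟨0, le_rfl, hT⟩ 0 a 0 L K := by
    refine ⟨fun t ht => ?_, fun x _ => ?_, fun t ht x _ => ?_, ?_⟩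
    · refine LipschitzOnWith.of_dist_le_mul fun x _ y _ => ?_
      simp only [Real.dist_eq, key, hK]
      have e : 1 + (q t - 1) * Real.sin x ^ 2 - (1 + (q t - 1) * Real.sin y ^ 2)
        = (q t - 1) * ((Real.sin x + Real.sin y) * (Real.sin x - Real.sin y)) := by ring
      rw [e, abs_mul, abs_mul]
      have h1 : |Real.sin x + Real.sin y| ≤ 2 := by
        have := abs_add_le (Real.sin x) (Real.sin y)
        linarith [Real.abs_sin_le_one x, Real.abs_sin_le_one y]
      have h2 : |Real.sin x - Real.sin y| ≤ |x - y| := by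
        have := Real.lipschitzWith_sin.dist_le_mul x y
        simpa [Real.dist_eq] using this
      calc |q t - 1| * (|Real.sin x + Real.sin y| * |Real.sin x - Real.sin y|)
          ≤ (1 + B) * (2 * |x - y|) := by gcongr; exact hq1 t ht
        _ = 2 * (1 + B) * |x - y| := by ring
    · fun_prop
    · rw [Real.norm_eq_abs]
      have h2 := hB t ht
      rw [Real.norm_eq_abs] at h2
      calc |Real.cos x ^ 2 + q t * Real.sin x ^ 2|
          ≤ |Real.cos x ^ 2| + |q t * Real.sin x ^ 2| := abs_add_le _ _
        _ = Real.cos x ^ 2 + |q t| * Real.sin x ^ 2 := by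
          rw [abs_mul, abs_of_nonneg (sq_nonneg (Real.cos x)), abs_of_nonneg (sq_nonneg (Real.sin x))]
        _ ≤ 1 + B * 1 := by
          gcongr
          · exact Real.cos_sq_le_one x
          · exact Real.sin_sq_le_one x
        _ = L := by simp [hL]
    · simp [ha, hL, hT]
  obtain ⟨θ, h0, hθ⟩ := hpl.exists_eq_forall_mem_Icc_hasDerivWithinAt₀
  exact ⟨θ, h0, hθ⟩

/-- The scalar equation `y'' = -q y` has a solution on `[0, T]` with `y 0 = 0`, `y' 0 = 1`. -/
lemma exists_scalarSolution {q : ℝ → ℝ} {T : ℝ} (hT : 0 ≤ T) (hq : ContinuousOn q (Icc 0 T)) :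
    ∃ y y' : ℝ → ℝ, (∀ t ∈ Icc 0 T, HasDerivWithinAt y (y' t) (Icc 0 T) t ∧
      HasDerivWithinAt y' (-q t * y t) (Icc 0 T) t) ∧ y 0 = 0 ∧ y' 0 = 1 := by
  have hext : ∀ t ∈ Icc 0 T, IccExtend hT ((Icc 0 T).domRestrict q) t = q t := fun t ht => by
    rw [IccExtend_of_mem _ _ ht]; rfl
  have hQ : Continuous (IccExtend hT ((Icc 0 T).domRestrict q)) :=
    (continuousOn_iff_continuous_domRestrict.1 hq).Icc_extend'
  set Q := IccExtend hT ((Icc 0 T).domRestrict q) with hQdef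
  obtain ⟨θ, h0, hθ⟩ := exists_pruferAngle hQ hT
  have hθc : ContinuousOn θ (Icc 0 T) := fun t ht => (hθ t ht).continuousWithinAt
  have hΘ : Continuous (IccExtend hT ((Icc 0 T).domRestrict θ)) :=
    (continuousOn_iff_continuous_domRestrict.1 hθc).Icc_extend'
  have hextθ : ∀ t ∈ Icc 0 T, IccExtend hT ((Icc 0 T).domRestrict θ) t = θ t := fun t ht => by
    rw [IccExtend_of_mem _ _ ht]; rfl
  set Θ := IccExtend hT ((Icc 0 T).domRestrict θ) with hΘdef
  -- With y = R sin θ and y' = R cos θ, the equation splits into the angle equation and R'/R = (1 -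
  -- q) sin θ cos θ, so R is the exponential of a primitive of `g`. The constant extensions `Q`, `Θ`
  -- make `g` continuous on all of ℝ.
  set g : ℝ → ℝ := fun t => (1 - Q t) * Real.sin (Θ t) * Real.cos (Θ t) with hg
  have hgc : Continuous g := by fun_prop
  have hR : ∀ t, HasDerivAt (fun t => Real.exp (∫ s in (0 : ℝ)..t, g s))
      (Real.exp (∫ s in (0 : ℝ)..t, g s) * g t) t := fun t =>
    (intervalIntegral.integral_hasDerivAt_right (hgc.intervalIntegrable _ _)
      (hgc.stronglyMeasurableAtFilter _ _) hgc.continuousAt).exp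
  refine ⟨fun t => Real.exp (∫ s in (0 : ℝ)..t, g s) * Real.sin (θ t),
    fun t => Real.exp (∫ s in (0 : ℝ)..t, g s) * Real.cos (θ t), fun t ht => ⟨?_, ?_⟩, ?_, ?_⟩
  · convert! (hR t).hasDerivWithinAt.mul (hθ t ht).sin using 1
    simp only [hg, hextθ t ht]
    linear_combination (-Real.exp (∫ s in (0 : ℝ)..t, g s) * Real.cos (θ t))
      * Real.sin_sq_add_cos_sq (θ t)
  · convert! (hR t).hasDerivWithinAt.mul (hθ t ht).cos using 1
    simp only [hg, hextθ t ht, hext t ht]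
    linear_combination (q t * Real.exp (∫ s in (0 : ℝ)..t, g s) * Real.sin (θ t))
      * Real.sin_sq_add_cos_sq (θ t)
  · simp [h0]
  · simp [h0]

/-- A solution of `y'' = -q y` with `y' 0 ≠ 0` has only simple zeros. -/
lemma scalarSolution_deriv_ne_zero {q y y' : ℝ → ℝ} {T : ℝ} (hq : ContinuousOn q (Icc 0 T))
    (h : ∀ t ∈ Icc 0 T, HasDerivWithinAt y (y' t) (Icc 0 T) t ∧
      HasDerivWithinAt y' (-q t * y t) (Icc 0 T) t) (h0 : y' 0 ≠ 0)
    {t : ℝ} (ht : t ∈ Icc 0 T) (hy : y t = 0) : y' t ≠ 0 := by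
  intro hy'
  obtain ⟨B, hB⟩ := isCompact_Icc.exists_bound_of_continuousOn hq
  have hB0 : 0 ≤ B := (norm_nonneg _).trans (hB t ht)
  obtain ⟨K, hK⟩ : ∃ K : NNReal, (K : ℝ) = 1 + B := ⟨⟨1 + B, by positivity⟩, rfl⟩
  have hsub : Icc 0 t ⊆ Icc 0 T := Icc_subset_Icc_right ht.2
  have hd : ∀ s ∈ Icc 0 t, HasDerivWithinAt (fun s => (y s, y' s)) (y' s, -q s * y s)
      (Icc 0 t) s := fun s hs =>
    ((h s (hsub hs)).1.prodMk (h s (hsub hs)).2).mono hsub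
  -- Uniqueness backwards from `t`: with zero data there, the solution vanishes down to time 0,
  -- against y'(0) ≠ 0.
  have key := ODE_solution_unique_of_mem_Icc_left (a := 0) (b := t) (s := fun _ => univ)
    (K := K)
    (v := fun s (p : ℝ × ℝ) => (p.2, -q s * p.1)) (f := fun s => (y s, y' s)) (g := fun _ => 0)
    (fun s hs => ?_) (fun s hs => (hd s hs).continuousWithinAt)
    (fun s hs => (hd s (Ioc_subset_Icc_self hs)).mono_of_mem_nhdsWithin
      (Icc_mem_nhdsLE_of_mem hs))
    (fun _ _ => mem_univ _) continuousOn_const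
    (fun s hs => ?_) (fun _ _ => mem_univ _) ?_
  · have := key ⟨le_rfl, ht.1⟩
    simp only [Prod.mk_eq_zero] at this
    exact h0 this.2
  · refine LipschitzOnWith.of_dist_le_mul fun p _ r _ => ?_
    have h2 := hB s (hsub (Ioc_subset_Icc_self hs))
    simp only [Prod.dist_eq, Real.dist_eq, hK]
    have e : -q s * p.1 - -q s * r.1 = -q s * (p.1 - r.1) := by ring
    rw [e, abs_mul, abs_neg]
    rw [Real.norm_eq_abs] at h2
    have m1 := le_max_left |p.1 - r.1| |p.2 - r.2|
    have m2 := le_max_right |p.1 - r.1| |p.2 - r.2|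
    set m := max |p.1 - r.1| |p.2 - r.2|
    have m0 : 0 ≤ m := (abs_nonneg _).trans m1
    refine max_le (by nlinarith) ?_
    calc |q s| * |p.1 - r.1| ≤ B * m := by gcongr
      _ ≤ (1 + B) * m := by nlinarith
  · simpa using! hasDerivWithinAt_const s (Iic s) (0 : ℝ × ℝ)
  · simp [hy, hy']

/-- Sturm comparison: if `q ≥ κ > 0`, a solution of `y'' = -q y` with `y 0 = 0`, `y' 0 = 1` has a
zero in `(0, π/√κ]`. -/
lemma exists_zero_of_le {q y y' : ℝ → ℝ} {T κ : ℝ} (hκ : 0 < κ)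
    (h : ∀ t ∈ Icc 0 T, HasDerivWithinAt y (y' t) (Icc 0 T) t ∧
      HasDerivWithinAt y' (-q t * y t) (Icc 0 T) t)
    (hy0 : y 0 = 0) (hy1 : y' 0 = 1) (hq : ∀ t ∈ Ioc 0 T, κ ≤ q t) (hT : Real.pi / √κ ≤ T) :
    ∃ t ∈ Ioc 0 (Real.pi / √κ), y t = 0 := by
  set k := √κ with hk
  have hk0 : 0 < k := Real.sqrt_pos.2 hκ
  have hkk : k * k = κ := Real.mul_self_sqrt hκ.le
  set τ := Real.pi / k with hτ
  have hτ0 : 0 < τ := div_pos Real.pi_pos hk0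
  have hkτ : k * τ = Real.pi := by rw [hτ]; field_simp
  have hsub : Icc 0 τ ⊆ Icc 0 T := Icc_subset_Icc_right hT
  by_contra! hne
  have hyc : ContinuousOn y (Icc 0 τ) := fun t ht => ((h t (hsub ht)).1.mono hsub).continuousWithinAt
  have hyc' : ContinuousOn y' (Icc 0 τ) :=
    fun t ht => ((h t (hsub ht)).2.mono hsub).continuousWithinAt
  -- `y` is positive just after `0`
  obtain ⟨s, hs, hys⟩ : ∃ s ∈ Ioc 0 τ, 0 < y s := by
    have hd := (h 0 ⟨le_rfl, hτ0.le.trans hT⟩).1.mono_of_mem_nhdsWithin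
      (Icc_mem_nhdsGE (hτ0.trans_le hT))
    rw [hy1] at hd
    have h1 := hasDerivWithinAt_iff_tendsto_slope.1 hd
    rw [Ici_sdiff_left] at h1
    have h2 : ∀ᶠ s in 𝓝[>] (0 : ℝ), 0 < slope y 0 s := h1.eventually (lt_mem_nhds one_pos)
    obtain ⟨s, hs1, hs2⟩ := (h2.and (Ioc_mem_nhdsGT hτ0)).exists
    refine ⟨s, hs2, ?_⟩
    rw [slope_def_field, hy0, sub_zero, sub_zero] at hs1
    exact (div_pos_iff_of_pos_right hs2.1).1 hs1
  have hpos : ∀ t ∈ Ioc 0 τ, 0 < y t := by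
    intro t ht
    by_contra! hle
    have hss : uIcc s t ⊆ Ioc 0 τ := by
      intro u hu
      rw [mem_uIcc] at hu
      rcases hu with hu | hu
      · exact ⟨hs.1.trans_le hu.1, hu.2.trans ht.2⟩
      · exact ⟨ht.1.trans_le hu.1, hu.2.trans hs.2⟩
    obtain ⟨u, hu, hu0⟩ := intermediate_value_uIcc
      (hyc.mono (hss.trans Ioc_subset_Icc_self)) (show (0 : ℝ) ∈ uIcc (y s) (y t) from by
        rw [mem_uIcc]; exact Or.inr ⟨hle, hys.le⟩)
    exact hne u (hss hu) hu0
  -- This Wronskian of y and sin(kt) has derivative (κ - q) y sin(kt) ≤ 0 and vanishes at 0, but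
  -- equals k y(τ) > 0 at τ = π/k.
  have hanti : AntitoneOn (fun t => y' t * Real.sin (k * t) - y t * (k * Real.cos (k * t)))
      (Icc 0 τ) := by
    refine antitoneOn_of_hasDerivWithinAt_nonpos (convex_Icc 0 τ) (by fun_prop)
      (f' := fun t => (κ - q t) * (y t * Real.sin (k * t))) (fun t ht => ?_) (fun t ht => ?_)
    · rw [interior_Icc] at ht ⊢
      have hm := hsub (Ioo_subset_Icc_self ht)
      have hsub' : Ioo 0 τ ⊆ Icc 0 T := Ioo_subset_Icc_self.trans hsub
      have hkt : HasDerivWithinAt (fun t => k * t) k (Ioo 0 τ) t := by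
        simpa using (hasDerivWithinAt_id t (Ioo 0 τ)).const_mul k
      convert! (((h t hm).2.mono hsub').mul hkt.sin).sub
        (((h t hm).1.mono hsub').mul (hkt.cos.const_mul k)) using 1
      rw [← hkk]; ring
    · rw [interior_Icc] at ht
      have h1 := hq t ⟨ht.1, ht.2.le.trans hT⟩
      have h2 := hpos t ⟨ht.1, ht.2.le⟩
      have h3 : 0 < Real.sin (k * t) := Real.sin_pos_of_pos_of_lt_pi (mul_pos hk0 ht.1)
        (by rw [← hkτ]; exact mul_lt_mul_of_pos_left ht.2 hk0)
      have := mul_pos h2 h3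
      nlinarith
  have := hanti ⟨le_rfl, hτ0.le⟩ ⟨hτ0.le, le_rfl⟩ hτ0.le
  simp only [hkτ, Real.sin_pi, Real.cos_pi, mul_zero, Real.sin_zero, hy0, zero_mul] at this
  have h2 := mul_pos (hpos τ ⟨hτ0, le_rfl⟩) hk0
  linarith

end ScalarEquation

/-! ### Differentiability of the local flow in a normed space. -/

section LocalFlow

open Set Metric
open scoped NNReal

variable {E : Type*} [NormedAddCommGroup E] [NormedSpace ℝ E]

/-- Second order Taylor estimate for a map with Lipschitz derivative. -/
lemma norm_taylor_le {f : E → E} {s : Set E} {C : ℝ≥0} (hs : Convex ℝ s)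
    (hd : ∀ z ∈ s, DifferentiableAt ℝ f z) (hC : LipschitzOnWith C (fderiv ℝ f) s)
    {x y : E} (hx : x ∈ s) (hy : y ∈ s) :
    ‖f x - f y - fderiv ℝ f y (x - y)‖ ≤ C * ‖x - y‖ ^ 2 := by
  have hseg : segment ℝ y x ⊆ s := hs.segment_subset hy hx
  have := (convex_segment (𝕜 := ℝ) y x).norm_image_sub_le_of_norm_hasFDerivWithin_le'
    (f := f) (f' := fderiv ℝ f) (φ := fderiv ℝ f y) (C := C * ‖x - y‖)
    (fun z hz => (hd z (hseg hz)).hasFDerivAt.hasFDerivWithinAt) (fun z hz => ?_)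
    (left_mem_segment ℝ y x) (right_mem_segment ℝ y x)
  · calc _ ≤ _ := this
      _ = _ := by ring
  · rw [← dist_eq_norm]
    refine (hC.dist_le_mul z (hseg hz) y hy).trans ?_
    gcongr
    rw [dist_eq_norm]
    obtain ⟨a, b, ha, hb, hab, rfl⟩ := hz
    have : a • y + b • x - y = b • (x - y) := by
      rw [eq_sub_of_add_eq hab]; module
    rw [this, norm_smul, Real.norm_of_nonneg hb]
    exact mul_le_of_le_one_left (norm_nonneg _) (by linarith)

lemma gronwallBound_zero_eq_mul (K ε x : ℝ) :
    gronwallBound 0 K ε x = ε * gronwallBound 0 K 1 x := by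
  unfold gronwallBound
  split_ifs <;> ring

/-- Differentiability of the flow in the initial point: the derivative is the fundamental solution
of the linearised equation. -/
lemma hasFDerivAt_flow {f : E → E} {s : Set E} {K C : ℝ≥0} (hs : Convex ℝ s)
    (hd : ∀ z ∈ s, DifferentiableAt ℝ f z) (hK : ∀ z ∈ s, ‖fderiv ℝ f z‖ ≤ K)
    (hC : LipschitzOnWith C (fderiv ℝ f) s) {τ : ℝ} (hτ : 0 ≤ τ) {α : E → ℝ → E} {x₀ : E}
    (hα : ∀ᶠ x in 𝓝 x₀, α x 0 = x ∧
      ∀ t ∈ Icc 0 τ, α x t ∈ s ∧ HasDerivWithinAt (α x) (f (α x t)) (Icc 0 τ) t)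
    {A : ℝ → E →L[ℝ] E} (hA0 : A 0 = ContinuousLinearMap.id ℝ E)
    (hA : ∀ t ∈ Icc 0 τ, HasDerivWithinAt A ((fderiv ℝ f (α x₀ t)).comp (A t)) (Icc 0 τ) t) :
    HasFDerivAt (fun x => α x τ) (A τ) x₀ := by
  obtain ⟨h00, h0⟩ := hα.self_of_nhds
  have hlip : LipschitzOnWith K f s :=
    hs.lipschitzOnWith_of_nnnorm_fderiv_le hd (fun z hz => hK z hz)
  have right : ∀ {F : Type _} [NormedAddCommGroup F] [NormedSpace ℝ F] {g : ℝ → F} {g' : F} {t},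
      t ∈ Ico 0 τ → HasDerivWithinAt g g' (Icc 0 τ) t → HasDerivWithinAt g g' (Ici t) t :=
    fun ht h => h.mono_of_mem_nhdsWithin (Icc_mem_nhdsGE_of_mem ht)
  -- `D * ‖x - x₀‖ ^ 2` bounds the Taylor remainder of `f` between two trajectories, which stay
  -- within `exp (K τ) * ‖x - x₀‖` of each other; `G` is the Gronwall factor for zero initial error.
  set D : ℝ := C * Real.exp (K * τ) ^ 2 with hD
  set G : ℝ := gronwallBound 0 K 1 τ with hG
  have main : ∀ᶠ x in 𝓝 x₀, ‖α x τ - α x₀ τ - A τ (x - x₀)‖ ≤ D * G * ‖x - x₀‖ ^ 2 := by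
    filter_upwards [hα] with x hx
    obtain ⟨hx0, hx⟩ := hx
    have hdist : ∀ t ∈ Icc 0 τ, ‖α x t - α x₀ t‖ ≤ ‖x - x₀‖ * Real.exp (K * τ) := by
      intro t ht
      have := dist_le_of_trajectories_ODE_of_mem (v := fun _ => f) (s := fun _ => s)
        (δ := ‖x - x₀‖) (fun _ _ => hlip)
        (fun t ht => (hx t ht).2.continuousWithinAt)
        (fun t ht => right ht (hx t (Ico_subset_Icc_self ht)).2)
        (fun t ht => (hx t (Ico_subset_Icc_self ht)).1)
        (fun t ht => (h0 t ht).2.continuousWithinAt)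
        (fun t ht => right ht (h0 t (Ico_subset_Icc_self ht)).2)
        (fun t ht => (h0 t (Ico_subset_Icc_self ht)).1)
        (by rw [hx0, h00, dist_eq_norm]) t ht
      rw [dist_eq_norm] at this
      refine this.trans ?_
      gcongr
      linarith [ht.2]
    have hder : ∀ t ∈ Icc 0 τ, HasDerivWithinAt (fun t => α x t - α x₀ t - A t (x - x₀))
        (f (α x t) - f (α x₀ t) - fderiv ℝ f (α x₀ t) (A t (x - x₀))) (Icc 0 τ) t := by
      intro t ht
      exact ((hx t ht).2.sub (h0 t ht).2).sub
        (((hA t ht).clm_apply (hasDerivWithinAt_const t _ (x - x₀))).congr_deriv (by simp))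
    have := norm_le_gronwallBound_of_norm_deriv_right_le (δ := 0) (K := K)
      (ε := D * ‖x - x₀‖ ^ 2) (fun t ht => (hder t ht).continuousWithinAt)
      (fun t ht => right ht (hder t (Ico_subset_Icc_self ht))) (by simp [hx0, h00, hA0])
      (fun t ht => ?_) τ ⟨hτ, le_rfl⟩
    · rw [sub_zero, gronwallBound_zero_eq_mul] at this
      calc _ ≤ _ := this
        _ = _ := by ring
    · have ht' := Ico_subset_Icc_self ht
      have e : f (α x t) - f (α x₀ t) - fderiv ℝ f (α x₀ t) (A t (x - x₀))
          = fderiv ℝ f (α x₀ t) (α x t - α x₀ t - A t (x - x₀))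
            + (f (α x t) - f (α x₀ t) - fderiv ℝ f (α x₀ t) (α x t - α x₀ t)) := by
        rw [map_sub (fderiv ℝ f (α x₀ t)) (α x t - α x₀ t)]; abel
      rw [e]
      refine (norm_add_le _ _).trans (add_le_add ?_ ?_)
      · exact (ContinuousLinearMap.le_opNorm _ _).trans (by gcongr; exact hK _ (h0 t ht').1)
      · refine (norm_taylor_le hs hd hC (hx t ht').1 (h0 t ht').1).trans ?_
        calc (C : ℝ) * ‖α x t - α x₀ t‖ ^ 2 ≤ C * (‖x - x₀‖ * Real.exp (K * τ)) ^ 2 := by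
              gcongr; exact hdist t ht'
          _ = D * ‖x - x₀‖ ^ 2 := by rw [hD]; ring
  rw [hasFDerivAt_iff_isLittleO]
  refine Asymptotics.IsBigO.trans_isLittleO (g := fun x => ‖x - x₀‖ ^ 2) ?_ ?_
  · exact Asymptotics.IsBigO.of_bound (D * G) (main.mono fun x hx => by simpa using hx)
  · exact (Asymptotics.isLittleO_norm_pow_id one_lt_two).comp_tendsto
      (tendsto_sub_nhds_zero_iff.2 Filter.tendsto_id)

/-- Picard–Lindelöf, keeping track of the ball which contains the solution. -/
lemma exists_solution_mem_closedBall [CompleteSpace E] {f : ℝ → E → E} {tmin tmax : ℝ}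
    {t₀ : Icc tmin tmax} {x₀ x : E} {a r L K : ℝ≥0} (hf : IsPicardLindelof f t₀ x₀ a r L K)
    (hx : x ∈ closedBall x₀ r) :
    ∃ α : ℝ → E, α t₀ = x ∧ ∀ t ∈ Icc tmin tmax, α t ∈ closedBall x₀ a ∧
      HasDerivWithinAt α (f t (α t)) (Icc tmin tmax) t := by
  obtain ⟨α, hα⟩ := ODE.FunSpace.exists_isFixedPt_next hf hx
  refine ⟨α.compProj, by rw [ODE.FunSpace.compProj_val, ← hα, ODE.FunSpace.next_apply₀],
    fun t ht ↦ ⟨α.compProj_mem_closedBall hf.mul_max_le, ?_⟩⟩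
  apply ODE.hasDerivWithinAt_picard_Icc t₀.2 hf.continuousOn_uncurry
    α.continuous_compProj.continuousOn (fun _ ht' ↦ α.compProj_mem_closedBall hf.mul_max_le)
    x ht |>.congr_of_mem _ ht
  intro t' ht'
  nth_rw 1 [← hα]
  rw [ODE.FunSpace.compProj_of_mem ht', ODE.FunSpace.next_apply]

/-- A linear equation has a fundamental solution on short intervals. -/
lemma exists_fundamentalSolution [CompleteSpace E] {B : ℝ → E →L[ℝ] E} {τ : ℝ} {K : ℝ≥0}
    (hτ : 0 ≤ τ) (hB : ContinuousOn B (Icc 0 τ)) (hK : ∀ t ∈ Icc 0 τ, ‖B t‖ ≤ K)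
    (hKτ : 2 * K * τ ≤ 1) :
    ∃ A : ℝ → E →L[ℝ] E, A 0 = ContinuousLinearMap.id ℝ E ∧
      ∀ t ∈ Icc 0 τ, HasDerivWithinAt A ((B t).comp (A t)) (Icc 0 τ) t := by
  -- In the unit ball around the identity ‖A‖ ≤ 2, so the field has norm at most 2K, and 2Kτ ≤ 1
  -- keeps the solution in that ball.
  have hpl : IsPicardLindelof (fun t (A : E →L[ℝ] E) => (B t).comp A) (tmin := 0) (tmax := τ)
      ⟨0, le_rfl, hτ⟩ (ContinuousLinearMap.id ℝ E) 1 0 (2 * K) K := by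
    refine ⟨fun t ht => ?_, fun A _ => ?_, fun t ht A hA => ?_, ?_⟩
    · refine LipschitzOnWith.of_dist_le_mul fun A _ A' _ => ?_
      rw [dist_eq_norm, dist_eq_norm, ← ContinuousLinearMap.comp_sub]
      exact (ContinuousLinearMap.opNorm_comp_le _ _).trans (by gcongr; exact hK t ht)
    · exact hB.clm_comp continuousOn_const
    · have h1 : ‖A‖ ≤ 2 := by
        have h2 : ‖A - ContinuousLinearMap.id ℝ E‖ ≤ 1 := by
          rw [mem_closedBall, dist_eq_norm] at hA; simpa using hA
        have h3 : ‖ContinuousLinearMap.id ℝ E‖ ≤ 1 := ContinuousLinearMap.norm_id_le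
        have h4 := norm_add_le (A - ContinuousLinearMap.id ℝ E) (ContinuousLinearMap.id ℝ E)
        rw [sub_add_cancel] at h4
        linarith
      refine (ContinuousLinearMap.opNorm_comp_le _ _).trans ?_
      push_cast
      rw [mul_comm (2 : ℝ)]
      gcongr
      exact hK t ht
    · simpa [hτ] using hKτ
  exact hpl.exists_eq_forall_mem_Icc_hasDerivWithinAt₀

/-- A `C²` vector field has a local flow, which is differentiable in the initial point; its
derivative transports the solutions of the linearised equation. -/
theorem exists_localFlow [CompleteSpace E] {f : E → E} {z₀ : E} (hf : ContDiffAt ℝ 2 f z₀)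
    {U : Set E} (hU : U ∈ 𝓝 z₀) :
    ∃ ε > 0, ∃ ρ > 0, ∃ α : E → ℝ → E,
      (∀ x ∈ ball z₀ ρ, α x 0 = x ∧
        ∀ t ∈ Icc 0 ε, α x t ∈ U ∧ HasDerivWithinAt (α x) (f (α x t)) (Icc 0 ε) t) ∧
      ∀ x₀ ∈ ball z₀ ρ, ∀ τ ∈ Icc 0 ε, ∃ A : E →L[ℝ] E, HasFDerivAt (fun x => α x τ) A x₀ ∧
        ∀ J : ℝ → E, (∀ t ∈ Icc 0 τ,
          HasDerivWithinAt J (fderiv ℝ f (α x₀ t) (J t)) (Icc 0 τ) t) → A (J 0) = J τ := by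
  obtain ⟨C, s₁, hs₁, hC⟩ := (hf.fderiv_right (m := 1) (by norm_num)).exists_lipschitzOnWith
  have hdiff : ∀ᶠ z in 𝓝 z₀, DifferentiableAt ℝ f z :=
    (hf.eventually (by simp)).mono fun z hz => hz.differentiableAt (by simp)
  obtain ⟨K, hK⟩ : ∃ K : ℝ≥0, ∀ᶠ z in 𝓝 z₀, ‖fderiv ℝ f z‖ ≤ K := by
    have hc : ContinuousAt (fderiv ℝ f) z₀ :=
      (hf.fderiv_right (m := 1) (by norm_num)).continuousAt
    refine ⟨‖fderiv ℝ f z₀‖₊ + 1, (hc.norm.eventually (gt_mem_nhds (lt_add_one _))).mono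
      fun z hz => by push_cast; exact hz.le⟩
  obtain ⟨L, hL⟩ : ∃ L : ℝ≥0, ∀ᶠ z in 𝓝 z₀, ‖f z‖ ≤ L := by
    refine ⟨‖f z₀‖₊ + 1, (hf.continuousAt.norm.eventually (gt_mem_nhds (lt_add_one _))).mono
      fun z hz => by push_cast; exact hz.le⟩
  obtain ⟨a, ha, hball⟩ := (nhds_basis_closedBall (x := z₀)).mem_iff.1
    (Filter.inter_mem (Filter.inter_mem hs₁ hU) (hdiff.and (hK.and hL)))
  lift a to ℝ≥0 using ha.le
  have ha' : (0 : ℝ) < a := ha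
  set s := closedBall z₀ (a : ℝ) with hs
  have hconv : Convex ℝ s := convex_closedBall _ _
  have hCs : LipschitzOnWith C (fderiv ℝ f) s := hC.mono fun z hz => (hball hz).1.1
  have hds : ∀ z ∈ s, DifferentiableAt ℝ f z := fun z hz => (hball hz).2.1
  have hKs : ∀ z ∈ s, ‖fderiv ℝ f z‖ ≤ K := fun z hz => (hball hz).2.2.1
  have hLs : ∀ z ∈ s, ‖f z‖ ≤ L := fun z hz => (hball hz).2.2.2
  have hlip : LipschitzOnWith K f s :=
    hconv.lipschitzOnWith_of_nnnorm_fderiv_le hds (fun z hz => hKs z hz)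
  -- The first bound keeps trajectories from the half ball inside the ball of radius `a`; the second
  -- is what the fundamental solution needs.
  set ε : ℝ := min (a / 2 / (L + 1)) (1 / (2 * (K + 1))) with hε
  have hε0 : 0 < ε := by positivity
  have hLε : L * ε ≤ a / 2 := by
    have h1 : ε * (L + 1) ≤ a / 2 := (le_div_iff₀ (by positivity)).1 (min_le_left _ _)
    nlinarith
  have hKε : 2 * K * ε ≤ 1 := by
    have h1 : ε * (2 * (K + 1)) ≤ 1 := (le_div_iff₀ (by positivity)).1 (min_le_right _ _)
    nlinarith
  have hpl : IsPicardLindelof (fun _ => f) (tmin := 0) (tmax := ε) ⟨0, le_rfl, hε0.le⟩ z₀ a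
      (a / 2) L K := by
    refine IsPicardLindelof.of_time_independent hLs hlip ?_
    simp only [sub_zero, sub_self, max_eq_left hε0.le]
    push_cast
    linarith
  choose! α hα using fun x (hx : x ∈ closedBall z₀ ((a / 2 : ℝ≥0) : ℝ)) =>
    exists_solution_mem_closedBall hpl hx
  have hsub : ball z₀ ((a : ℝ) / 2) ⊆ closedBall z₀ ((a / 2 : ℝ≥0) : ℝ) := by
    push_cast; exact ball_subset_closedBall
  refine ⟨ε, hε0, a / 2, by positivity, α, fun x hx => ?_, fun x₀ hx₀ τ hτ => ?_⟩
  · obtain ⟨h1, h2⟩ := hα x (hsub hx)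
    exact ⟨h1, fun t ht => ⟨(hball (h2 t ht).1).1.2, (h2 t ht).2⟩⟩
  have hτs : Icc 0 τ ⊆ Icc 0 ε := Icc_subset_Icc_right hτ.2
  obtain ⟨h00, h0⟩ := hα x₀ (hsub hx₀)
  have hcont : ContinuousOn (fun t => fderiv ℝ f (α x₀ t)) (Icc 0 τ) :=
    hCs.continuousOn.comp (fun t ht => ((h0 t (hτs ht)).2.mono hτs).continuousWithinAt)
      fun t ht => (h0 t (hτs ht)).1
  obtain ⟨A, hA0, hA⟩ := exists_fundamentalSolution hτ.1 hcont
    (fun t ht => hKs _ (h0 t (hτs ht)).1) (by nlinarith [hτ.2, K.2])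
  refine ⟨A τ, ?_, fun J hJ => ?_⟩
  · refine hasFDerivAt_flow hconv hds hKs hCs hτ.1 ?_ hA0 hA
    filter_upwards [isOpen_ball.mem_nhds hx₀] with x hx
    obtain ⟨h1, h2⟩ := hα x (hsub hx)
    exact ⟨h1, fun t ht => ⟨(h2 t (hτs ht)).1, (h2 t (hτs ht)).2.mono hτs⟩⟩
  -- The difference solves the linear equation with initial value 0, so it vanishes.
  · have hder : ∀ t ∈ Icc 0 τ, HasDerivWithinAt (fun t => A t (J 0) - J t)
        (fderiv ℝ f (α x₀ t) (A t (J 0) - J t)) (Icc 0 τ) t := fun t ht => by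
      refine (((hA t ht).clm_apply (hasDerivWithinAt_const t _ (J 0))).sub (hJ t ht)).congr_deriv ?_
      simp
    have := eq_zero_of_abs_deriv_le_mul_abs_self_of_eq_zero_right (K := K)
      (fun t ht => (hder t ht).continuousWithinAt)
      (fun t ht => (hder t (Ico_subset_Icc_self ht)).mono_of_mem_nhdsWithin
        (Icc_mem_nhdsGE_of_mem ht)) (by simp [hA0])
      (fun t ht => (ContinuousLinearMap.le_opNorm _ _).trans
        (by gcongr; exact hKs _ (h0 t (hτs (Ico_subset_Icc_self ht))).1)) τ ⟨hτ.1, le_rfl⟩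
    exact sub_eq_zero.1 this

end LocalFlow

/-! ### Fields, brackets and derivatives read in charts. -/

section Calculus

open VectorField

variable {E : Type*} [NormedAddCommGroup E] [NormedSpace ℝ E]
  {M : Type*} [TopologicalSpace M] [ChartedSpace E M]

/-- The vector field `Y` read in the chart at `p`. -/
def chartField (p : M) (Y : VField E M) : E → E :=
  mpullback 𝓘(ℝ, E) 𝓘(ℝ, E) (extChartAt 𝓘(ℝ, E) p).symm Y

/-- The differential at `x` of the chart at `p`. -/
def chartVec (p x : M) : TangentSpace 𝓘(ℝ, E) x →L[ℝ] E :=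
  mfderiv 𝓘(ℝ, E) 𝓘(ℝ, E) (extChartAt 𝓘(ℝ, E) p) x

/-- The derivative of the function `f` along the vector field `X`. -/
def lieD (X : VField E M) (f : M → ℝ) (x : M) : ℝ := mfderiv 𝓘(ℝ, E) 𝓘(ℝ, ℝ) f x (X x)

/-- The function `f` is smooth at every point near `x`. -/
def SmoothFunNear (E : Type*) [NormedAddCommGroup E] [NormedSpace ℝ E]
    {M : Type*} [TopologicalSpace M] [ChartedSpace E M] (f : M → ℝ) (x : M) : Prop :=
  ∀ᶠ y in 𝓝 x, ContMDiffAt 𝓘(ℝ, E) 𝓘(ℝ, ℝ) ∞ f y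

lemma SmoothFunNear.eventually {f : M → ℝ} {x : M} (h : SmoothFunNear E f x) :
    ∀ᶠ y in 𝓝 x, SmoothFunNear E f y := eventually_eventually_nhds.2 h

lemma SmoothFunNear.mdifferentiableAt {f : M → ℝ} {x : M} (h : SmoothFunNear E f x) :
    MDifferentiableAt 𝓘(ℝ, E) 𝓘(ℝ, ℝ) f x := h.self_of_nhds.mdifferentiableAt (by simp)

variable [IsManifold 𝓘(ℝ, E) ∞ M]

lemma SmoothNear.eventually {Y : VField E M} {x : M} (h : SmoothNear Y x) :
    ∀ᶠ y in 𝓝 x, SmoothNear Y y := eventually_eventually_nhds.2 h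

lemma SmoothNear.mdifferentiableAt {Y : VField E M} {x : M} (h : SmoothNear Y x) :
    MDifferentiableAt 𝓘(ℝ, E) 𝓘(ℝ, E).tangent
      (fun z => (⟨z, Y z⟩ : TangentBundle 𝓘(ℝ, E) M)) x :=
  h.self_of_nhds.mdifferentiableAt (by simp)

omit [IsManifold 𝓘(ℝ, E) ∞ M] in
lemma mem_target_nhds {p x : M} (hx : x ∈ (extChartAt 𝓘(ℝ, E) p).source) :
    (extChartAt 𝓘(ℝ, E) p).target ∈ 𝓝 (extChartAt 𝓘(ℝ, E) p x) :=
  (isOpen_extChartAt_target p).mem_nhds ((extChartAt 𝓘(ℝ, E) p).map_source hx)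

lemma contMDiffAt_chart_symm {p : M} {z : E} (hz : z ∈ (extChartAt 𝓘(ℝ, E) p).target) :
    ContMDiffAt 𝓘(ℝ, E) 𝓘(ℝ, E) ∞ (extChartAt 𝓘(ℝ, E) p).symm z :=
  (contMDiffOn_extChartAt_symm p).contMDiffAt ((isOpen_extChartAt_target p).mem_nhds hz)

lemma contMDiffAt_chart {p x : M} (hx : x ∈ (extChartAt 𝓘(ℝ, E) p).source) :
    ContMDiffAt 𝓘(ℝ, E) 𝓘(ℝ, E) ∞ (extChartAt 𝓘(ℝ, E) p) x :=
  contMDiffAt_extChartAt' (by rwa [extChartAt_source] at hx)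

lemma chartVec_comp_mfderiv_symm {p : M} {z : E} (hz : z ∈ (extChartAt 𝓘(ℝ, E) p).target) :
    (mfderiv 𝓘(ℝ, E) 𝓘(ℝ, E) (extChartAt 𝓘(ℝ, E) p) ((extChartAt 𝓘(ℝ, E) p).symm z)).comp
      (mfderiv 𝓘(ℝ, E) 𝓘(ℝ, E) (extChartAt 𝓘(ℝ, E) p).symm z)
      = ContinuousLinearMap.id ℝ (TangentSpace 𝓘(ℝ, E) z) := by
  have := mfderiv_extChartAt_comp_mfderivWithin_extChartAt_symm (I := 𝓘(ℝ, E)) hz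
  simpa only [modelWithCornersSelf_coe, Set.range_id, mfderivWithin_univ] using! this

lemma mfderiv_symm_comp_chartVec {p : M} {z : E} (hz : z ∈ (extChartAt 𝓘(ℝ, E) p).target) :
    (mfderiv 𝓘(ℝ, E) 𝓘(ℝ, E) (extChartAt 𝓘(ℝ, E) p).symm z).comp
      (mfderiv 𝓘(ℝ, E) 𝓘(ℝ, E) (extChartAt 𝓘(ℝ, E) p) ((extChartAt 𝓘(ℝ, E) p).symm z))
      = ContinuousLinearMap.id ℝ (TangentSpace 𝓘(ℝ, E) ((extChartAt 𝓘(ℝ, E) p).symm z)) := by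
  have := mfderivWithin_extChartAt_symm_comp_mfderiv_extChartAt (I := 𝓘(ℝ, E)) hz
  simpa only [modelWithCornersSelf_coe, Set.range_id, mfderivWithin_univ] using! this

lemma isInvertible_mfderiv_symm {p : M} {z : E} (hz : z ∈ (extChartAt 𝓘(ℝ, E) p).target) :
    (mfderiv 𝓘(ℝ, E) 𝓘(ℝ, E) (extChartAt 𝓘(ℝ, E) p).symm z).IsInvertible :=
  .of_inverse (mfderiv_symm_comp_chartVec hz) (chartVec_comp_mfderiv_symm hz)

lemma chartVec_injective {p x : M} (hx : x ∈ (extChartAt 𝓘(ℝ, E) p).source) :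
    Function.Injective (chartVec (E := E) p x) := by
  have := isInvertible_mfderiv_extChartAt (I := 𝓘(ℝ, E)) hx
  exact this.bijective.injective

lemma chartField_apply_of_mem_target {p : M} (Y : VField E M) {z : E}
    (hz : z ∈ (extChartAt 𝓘(ℝ, E) p).target) :
    chartField p Y z = chartVec p ((extChartAt 𝓘(ℝ, E) p).symm z)
      (Y ((extChartAt 𝓘(ℝ, E) p).symm z)) := by
  have := ContinuousLinearMap.inverse_eq (mfderiv_symm_comp_chartVec hz)
    (chartVec_comp_mfderiv_symm hz)
  rw [chartField, mpullback_apply, this]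
  rfl

lemma chartField_apply {p x : M} (Y : VField E M) (hx : x ∈ (extChartAt 𝓘(ℝ, E) p).source) :
    chartField p Y (extChartAt 𝓘(ℝ, E) p x) = chartVec p x (Y x) := by
  rw [chartField_apply_of_mem_target Y ((extChartAt 𝓘(ℝ, E) p).map_source hx),
    (extChartAt 𝓘(ℝ, E) p).left_inv hx]

variable [CompleteSpace E]

lemma contDiffAt_chartField {p x : M} {Y : VField E M}
    (hx : x ∈ (extChartAt 𝓘(ℝ, E) p).source)
    (hY : ContMDiffAt 𝓘(ℝ, E) 𝓘(ℝ, E).tangent ∞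
      (fun z => (⟨z, Y z⟩ : TangentBundle 𝓘(ℝ, E) M)) x) :
    ContDiffAt ℝ ∞ (chartField p Y) (extChartAt 𝓘(ℝ, E) p x) := by
  have hz := (extChartAt 𝓘(ℝ, E) p).map_source hx
  rw [← contMDiffAt_vectorSpace_iff_contDiffAt (V := chartField p Y)]
  refine ContMDiffAt.mpullback_vectorField_preimage (n := ∞) ?_ (contMDiffAt_chart_symm hz)
    (isInvertible_mfderiv_symm hz) (by simp)
  rwa [(extChartAt 𝓘(ℝ, E) p).left_inv hx]

omit [CompleteSpace E] in
lemma isManifold_minSmoothness_two : IsManifold 𝓘(ℝ, E) (minSmoothness ℝ 2) M := by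
  rw [minSmoothness_of_isRCLikeNormedField]; infer_instance

/-- Naturality of the bracket under pullback by the inverse chart; on `E` itself the manifold
bracket is the usual one. -/
lemma chartField_ad {p x : M} {X Y : VField E M} (hx : x ∈ (extChartAt 𝓘(ℝ, E) p).source)
    (hX : SmoothNear X x) (hY : SmoothNear Y x) :
    chartField p (ad X Y) (extChartAt 𝓘(ℝ, E) p x)
      = lieBracket ℝ (chartField p X) (chartField p Y) (extChartAt 𝓘(ℝ, E) p x) := by
  have hz := (extChartAt 𝓘(ℝ, E) p).map_source hx
  have := isManifold_minSmoothness_two (E := E) (M := M)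
  have := isManifold_minSmoothness_two (E := E) (M := E)
  have h1 := hX.mdifferentiableAt
  have h2 := hY.mdifferentiableAt
  rw [← (extChartAt 𝓘(ℝ, E) p).left_inv hx] at h1 h2
  have := mpullback_mlieBracket h1 h2 (contMDiffAt_chart_symm hz)
    (by rw [minSmoothness_of_isRCLikeNormedField]; exact ENat.LEInfty.out)
  refine this.trans ?_
  rw [← mlieBracketWithin_univ, mlieBracketWithin_eq_lieBracketWithin]
  exact congrFun (lieBracketWithin_univ (E := E) (V := chartField p X) (W := chartField p Y)) _

lemma SmoothNear.ad {X Y : VField E M} {x : M} (hX : SmoothNear X x) (hY : SmoothNear Y x) :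
    SmoothNear (ad X Y) x := by
  have := isManifold_minSmoothness_two (E := E) (M := M)
  filter_upwards [hX, hY] with y h1 h2
  have : IsManifold 𝓘(ℝ, E) (((⊤ : ℕ∞) : ℕ∞ω) + 1) M := by simpa
  exact ContMDiffAt.mlieBracket_vectorField (n := ⊤) (m := ⊤) h1 h2
    (by rw [minSmoothness_of_isRCLikeNormedField]; simp)

omit [CompleteSpace E] in
/-- The derivative along a vector field, computed in a chart. -/
lemma lieD_eq_fderiv {p x : M} (X : VField E M) {f : M → ℝ}
    (hx : x ∈ (extChartAt 𝓘(ℝ, E) p).source) (hf : MDifferentiableAt 𝓘(ℝ, E) 𝓘(ℝ, ℝ) f x) :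
    lieD X f x = fderiv ℝ (f ∘ (extChartAt 𝓘(ℝ, E) p).symm) (extChartAt 𝓘(ℝ, E) p x)
      (chartField p X (extChartAt 𝓘(ℝ, E) p x)) := by
  have hz := (extChartAt 𝓘(ℝ, E) p).map_source hx
  have hl := (extChartAt 𝓘(ℝ, E) p).left_inv hx
  rw [chartField_apply X hx, ← mfderiv_eq_fderiv,
    mfderiv_comp (I' := 𝓘(ℝ, E)) _ (by rwa [hl])
      ((contMDiffAt_chart_symm hz).mdifferentiableAt (by simp))]
  have := mfderiv_symm_comp_chartVec hz
  rw [hl] at this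
  have h2 := DFunLike.congr_fun this (X x)
  have h3 : (mfderiv 𝓘(ℝ, E) 𝓘(ℝ, E) (extChartAt 𝓘(ℝ, E) p).symm (extChartAt 𝓘(ℝ, E) p x))
    (chartVec (E := E) p x (X x)) = X x := h2
  change _ = mfderiv 𝓘(ℝ, E) 𝓘(ℝ, ℝ) f _ ((mfderiv 𝓘(ℝ, E) 𝓘(ℝ, E)
    (extChartAt 𝓘(ℝ, E) p).symm (extChartAt 𝓘(ℝ, E) p x)) (chartVec (E := E) p x (X x)))
  rw [h3, hl]
  rfl

lemma SmoothFunNear.lieD {X : VField E M} {f : M → ℝ} {x : M} (hX : SmoothNear X x)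
    (hf : SmoothFunNear E f x) : SmoothFunNear E (lieD X f) x := by
  filter_upwards [hX, hf.eventually, extChartAt_source_mem_nhds (I := 𝓘(ℝ, E)) x] with y h1 h2 hy
  have hz := (extChartAt 𝓘(ℝ, E) x).map_source hy
  have hfc : ContDiffAt ℝ ∞ (f ∘ (extChartAt 𝓘(ℝ, E) x).symm) (extChartAt 𝓘(ℝ, E) x y) := by
    rw [← contMDiffAt_iff_contDiffAt]
    refine ContMDiffAt.comp (I' := 𝓘(ℝ, E)) _ ?_ (contMDiffAt_chart_symm hz)
    rw [(extChartAt 𝓘(ℝ, E) x).left_inv hy]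
    exact h2.self_of_nhds
  have key : ContDiffAt ℝ ∞ (fun z => fderiv ℝ (f ∘ (extChartAt 𝓘(ℝ, E) x).symm) z
      (chartField x X z)) (extChartAt 𝓘(ℝ, E) x y) :=
    (hfc.fderiv_right (m := ∞) (by simp)).clm_apply (contDiffAt_chartField hy h1)
  refine (key.contMDiffAt.comp (I' := 𝓘(ℝ, E)) y (contMDiffAt_chart hy)).congr_of_eventuallyEq ?_
  filter_upwards [h2, (isOpen_extChartAt_source x).mem_nhds hy] with w hw hws
  exact lieD_eq_fderiv X hws (hw.mdifferentiableAt (by simp))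

/-- Leibniz rule for the bracket with a combination of vector fields. -/
lemma ad_sum_smul {ι : Type*} (s : Finset ι) {X Y : VField E M} {a : ι → M → ℝ}
    {F : ι → VField E M} {x : M} (ha : ∀ i ∈ s, SmoothFunNear E (a i) x)
    (hF : ∀ i ∈ s, SmoothNear (F i) x) (hY : ∀ᶠ y in 𝓝 x, Y y = ∑ i ∈ s, a i y • F i y) :
    ad X Y x = ∑ i ∈ s, (lieD X (a i) x • F i x + a i x • ad X (F i) x) := by
  classical
  have e : ∀ᶠ y in 𝓝 x, Y y = (∑ i ∈ s, a i • F i : VField E M) y := hY.mono fun y hy => by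
    rw [hy, Finset.sum_apply]; rfl
  have : ad X Y x = ad X (∑ i ∈ s, a i • F i) x :=
    Filter.EventuallyEq.mlieBracket_vectorField_eq (Filter.EventuallyEq.refl _ X) e
  rw [this]
  clear this e hY
  induction s using Finset.induction_on with
  | empty => simp [ad]
  | insert i s hi ih =>
    rw [Finset.sum_insert hi, Finset.sum_insert hi,
      ← ih (fun j hj => ha j (Finset.mem_insert_of_mem hj))
        (fun j hj => hF j (Finset.mem_insert_of_mem hj))]
    have h1 := (ha i (Finset.mem_insert_self i s)).mdifferentiableAt
    have h2 := (hF i (Finset.mem_insert_self i s)).mdifferentiableAt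
    have h3 : MDifferentiableAt 𝓘(ℝ, E) 𝓘(ℝ, E).tangent
        (fun z => (⟨z, (∑ i ∈ s, a i • F i) z⟩ : TangentBundle 𝓘(ℝ, E) M)) x := by
      have := MDifferentiableAt.sum_section (I := 𝓘(ℝ, E)) (s := s) (x₀ := x)
        (t := fun i => a i • F i) (fun j hj =>
          (ha j (Finset.mem_insert_of_mem hj)).mdifferentiableAt.smul_section
            (hF j (Finset.mem_insert_of_mem hj)).mdifferentiableAt)
      simpa [Finset.sum_apply] using! this
    have e1 := mlieBracket_add_right (V := X) (h1.smul_section h2) h3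
    have e2 := mlieBracket_smul_right (V := X) h1 h2
    exact e1.trans (by rw [e2]; rfl)

end Calculus

/-! ### Comparing coefficients in a frame. -/

section LinearAlgebra

variable {N : Type*} [AddCommGroup N] [Module ℝ N] {m : ℕ} {u v : Fin m → N}

lemma eq_of_linearIndependent_sumElim (h : LinearIndependent ℝ (Sum.elim u v))
    {p q p' q' : Fin m → ℝ}
    (e : ∑ i, p i • u i + ∑ i, q i • v i = ∑ i, p' i • u i + ∑ i, q' i • v i) :
    p = p' ∧ q = q' := by
  have := Fintype.linearIndependent_iff.1 h (Sum.elim (p - p') (q - q')) (by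
    simp only [Fintype.sum_sum_type, Sum.elim_inl, Sum.elim_inr, Pi.sub_apply, sub_smul,
      Finset.sum_sub_distrib]
    rw [sub_add_sub_comm, e, sub_self])
  exact ⟨funext fun i => sub_eq_zero.1 (this (Sum.inl i)),
    funext fun i => sub_eq_zero.1 (this (Sum.inr i))⟩

lemma sum_smul_sum_eq_sum_mulVec (A : Matrix (Fin m) (Fin m) ℝ) (g : Fin m → ℝ)
    (u : Fin m → N) : ∑ j, g j • ∑ i, A i j • u i = ∑ i, A.mulVec g i • u i := by
  simp only [Finset.smul_sum, Matrix.mulVec, dotProduct, Finset.sum_smul, smul_smul]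
  rw [Finset.sum_comm]
  simp only [mul_comm]

end LinearAlgebra

/-! ### Frame computations for a regular dynamic pair. -/

section Frames

open Set

variable {E : Type*} [NormedAddCommGroup E] [NormedSpace ℝ E] [FiniteDimensional ℝ E]
  {M : Type*} [TopologicalSpace M] [ChartedSpace E M] [IsManifold 𝓘(ℝ, E) ∞ M]
  {m : ℕ} {X : VField E M} {V : Planes E M} {G : Fin m → VField E M}

omit [FiniteDimensional ℝ E] in
lemma IsLocalFrame.eventually {x : M} (hG : IsLocalFrame V G x) :
    ∀ᶠ y in 𝓝 x, IsLocalFrame V G y := by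
  filter_upwards [Filter.eventually_all.2 fun i => (hG.1 i).eventually,
    eventually_eventually_nhds.2 hG.2] with y h1 h2
  exact ⟨h1, h2⟩

omit [FiniteDimensional ℝ E] in
lemma IsLocalSection.eventually {Y : VField E M} {x : M} (hY : IsLocalSection V Y x) :
    ∀ᶠ y in 𝓝 x, IsLocalSection V Y y := by
  filter_upwards [hY.1.eventually, eventually_eventually_nhds.2 hY.2] with y h1 h2
  exact ⟨h1, h2⟩

/-- The coefficients of a smooth section in a smooth frame are smooth. -/
lemma exists_coefficients {Y : VField E M} {x : M} (hG : IsLocalFrame V G x)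
    (hY : IsLocalSection V Y x) :
    ∃ a : Fin m → M → ℝ, (∀ i, SmoothFunNear E (a i) x) ∧
      ∀ᶠ y in 𝓝 x, Y y = ∑ i, a i y • G i y := by
  have hxs := mem_extChartAt_source (I := 𝓘(ℝ, E)) x
  have hli : LinearIndependent ℝ (fun i => chartVec (E := E) x x (G i x)) :=
    (hG.2.self_of_nhds.1).map' (chartVec (E := E) x x).toLinearMap
      (LinearMap.ker_eq_bot.2 (chartVec_injective hxs))
  -- A left inverse `P` of the frame at `x`, kept constant nearby, turns the frame at `z` into a
  -- square matrix `B z` with `B = 1` at `x`. Hence `B` is invertible near `x`, and the coefficients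
  -- B⁻¹ P Y are smooth because inversion is.
  obtain ⟨P₀, hP₀⟩ := LinearMap.exists_leftInverse_of_injective
    (Fintype.linearCombination ℝ (fun i => chartVec (E := E) x x (G i x)))
    (LinearMap.ker_eq_bot.2 (linearIndependent_iff_injective_fintypeLinearCombination.1 hli))
  set P : E →L[ℝ] (Fin m → ℝ) := LinearMap.toContinuousLinearMap P₀ with hP
  set B : E → (Fin m → ℝ) →L[ℝ] (Fin m → ℝ) := fun z =>
    ∑ i, (ContinuousLinearMap.proj (R := ℝ) (φ := fun _ : Fin m => ℝ) i).smulRight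
      (P (chartField x (G i) z)) with hB
  have hBapp : ∀ z b, B z b = P (∑ i, b i • chartField x (G i) z) := fun z b => by
    simp [hB, map_sum]
  have hB1 : B (extChartAt 𝓘(ℝ, E) x x) = 1 := by
    ext1 b
    rw [hBapp]
    simp only [chartField_apply _ hxs]
    exact DFunLike.congr_fun hP₀ b
  have hBs : ∀ y ∈ (extChartAt 𝓘(ℝ, E) x).source, (∀ i, SmoothNear (G i) y) →
      ContDiffAt ℝ ∞ B (extChartAt 𝓘(ℝ, E) x y) := fun y hy hGy => by
    refine ContDiffAt.sum fun i _ => ?_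
    refine contDiffAt_const.smulRight ?_
    exact P.contDiff.contDiffAt.comp _ (contDiffAt_chartField hy (hGy i).self_of_nhds)
  have hunit : ∀ᶠ y in 𝓝 x, IsUnit (B (extChartAt 𝓘(ℝ, E) x y)) := by
    have hc : ContinuousAt (fun y => B (extChartAt 𝓘(ℝ, E) x y)) x :=
      ContinuousAt.comp (g := B) (hBs x hxs hG.1).continuousAt (continuousAt_extChartAt x)
    refine hc.eventually (Units.isOpen.mem_nhds ?_)
    change IsUnit (B (extChartAt 𝓘(ℝ, E) x x))
    rw [hB1]
    exact isUnit_one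
  refine ⟨fun i y => Ring.inverse (B (extChartAt 𝓘(ℝ, E) x y))
    (P (chartField x Y (extChartAt 𝓘(ℝ, E) x y))) i, fun i => ?_, ?_⟩
  · filter_upwards [hunit, (isOpen_extChartAt_source x).mem_nhds hxs,
      hG.eventually, hY.eventually] with y hu hy hGy hYy
    have hinv : ContDiffAt ℝ ∞ (fun z => Ring.inverse (B z)) (extChartAt 𝓘(ℝ, E) x y) := by
      obtain ⟨w, hw⟩ := hu
      refine ContDiffAt.comp (g := Ring.inverse) (extChartAt 𝓘(ℝ, E) x y) ?_ (hBs y hy hGy.1)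
      rw [← hw]
      exact contDiffAt_ringInverse ℝ w
    have h2 : ContDiffAt ℝ ∞ (fun z => Ring.inverse (B z) (P (chartField x Y z)) i)
        (extChartAt 𝓘(ℝ, E) x y) :=
      contDiffAt_pi.1 (hinv.clm_apply (P.contDiff.contDiffAt.comp _
        (contDiffAt_chartField hy hYy.1.self_of_nhds))) i
    exact h2.contMDiffAt.comp (I' := 𝓘(ℝ, E)) y (contMDiffAt_chart hy)
  · filter_upwards [hunit, (isOpen_extChartAt_source x).mem_nhds hxs, hG.2, hY.2]
      with y hu hy hGy hYy
    rw [← hGy.2, Submodule.mem_span_range_iff_exists_fun] at hYy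
    obtain ⟨b, hb⟩ := hYy
    have h1 : P (chartField x Y (extChartAt 𝓘(ℝ, E) x y)) = B (extChartAt 𝓘(ℝ, E) x y) b := by
      rw [hBapp, chartField_apply _ hy, ← hb, map_sum]
      simp only [chartField_apply _ hy, map_smul]
    have h2 : Ring.inverse (B (extChartAt 𝓘(ℝ, E) x y))
        (P (chartField x Y (extChartAt 𝓘(ℝ, E) x y))) = b := by
      rw [h1]
      exact DFunLike.congr_fun (Ring.inverse_mul_cancel _ hu) b
    rw [h2, hb]

lemma ad_eq_sum {Y : VField E M} {a : Fin m → M → ℝ} {x : M}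
    (ha : ∀ i, SmoothFunNear E (a i) x) (hG : ∀ i, SmoothNear (G i) x)
    (hYa : ∀ᶠ y in 𝓝 x, Y y = ∑ i, a i y • G i y) :
    ad X Y x = ∑ i, lieD X (a i) x • G i x + ∑ i, a i x • ad X (G i) x := by
  rw [ad_sum_smul Finset.univ (fun i _ => ha i) (fun i _ => hG i) hYa, Finset.sum_add_distrib]

/-- In a regular dynamic pair, a frame and its brackets with `X` are independent. -/
lemma IsRegular.linearIndependent (hreg : IsRegular m X V) {x : M} (hG : IsLocalFrame V G x) :
    LinearIndependent ℝ (Sum.elim (fun i => G i x) (fun i => ad X (G i) x)) := by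
  have : FiniteDimensional ℝ (TangentSpace 𝓘(ℝ, E) x) := inferInstanceAs (FiniteDimensional ℝ E)
  rw [linearIndependent_iff_card_le_finrank_span]
  -- By the Leibniz rule these 2m vectors span a space containing 𝓓, which has dimension 2m; so they
  -- are independent.
  have hle : bracketPlanes X V x ≤ Submodule.span ℝ
      (range (Sum.elim (fun i => G i x) (fun i => ad X (G i) x))) := by
    have hl : ∀ i, G i x ∈ Submodule.span ℝ
        (range (Sum.elim (fun i => G i x) (fun i => ad X (G i) x))) :=
      fun i => Submodule.subset_span ⟨Sum.inl i, rfl⟩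
    have hr : ∀ i, ad X (G i) x ∈ Submodule.span ℝ
        (range (Sum.elim (fun i => G i x) (fun i => ad X (G i) x))) :=
      fun i => Submodule.subset_span ⟨Sum.inr i, rfl⟩
    refine sup_le ?_ (Submodule.span_le.2 ?_)
    · rw [← hG.2.self_of_nhds.2, Submodule.span_le]
      rintro _ ⟨i, rfl⟩
      exact hl i
    · rintro _ ⟨Y, hY, rfl⟩
      obtain ⟨a, ha, hYa⟩ := exists_coefficients hG hY
      rw [ad_eq_sum ha hG.1 hYa]
      exact add_mem (sum_mem fun i _ => Submodule.smul_mem _ _ (hl i))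
        (sum_mem fun i _ => Submodule.smul_mem _ _ (hr i))
  have h2 := Submodule.finrank_mono hle
  rw [hreg.rank_eq x] at h2
  simpa [Set.finrank, two_mul] using h2

/-- The Leibniz rule twice, the second time for [X, Y] as a combination of the 2m fields G, [X, G].
The [X, G]-coefficient 2Xa + A₁a is the one that normal and parallel sections annihilate. -/
lemma ad_ad_eq_sum {Y : VField E M} {a : Fin m → M → ℝ} {x : M} (hX : SmoothNear X x)
    (ha : ∀ i, SmoothFunNear E (a i) x) (hG : ∀ i, SmoothNear (G i) x)
    (hYa : ∀ᶠ y in 𝓝 x, Y y = ∑ i, a i y • G i y) {A₀ A₁ : Matrix (Fin m) (Fin m) ℝ}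
    (hA : ∀ j, ad X (ad X (G j)) x = ∑ i, A₀ i j • G i x + ∑ i, A₁ i j • ad X (G i) x) :
    ad X (ad X Y) x
      = ∑ i, (lieD X (lieD X (a i)) x + A₀.mulVec (fun j => a j x) i) • G i x
        + ∑ i, (2 * lieD X (a i) x + A₁.mulVec (fun j => a j x) i) • ad X (G i) x := by
  have h1 : ∀ᶠ y in 𝓝 x, ad X Y y = ∑ k : Fin m ⊕ Fin m,
      Sum.elim (fun i => lieD X (a i)) a k y • Sum.elim G (fun i => ad X (G i)) k y := by
    filter_upwards [Filter.eventually_all.2 fun i => (ha i).eventually,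
      Filter.eventually_all.2 fun i => (hG i).eventually, eventually_eventually_nhds.2 hYa]
      with y h1 h2 h3
    rw [ad_eq_sum h1 h2 h3, Fintype.sum_sum_type]
    rfl
  rw [ad_sum_smul Finset.univ (fun k _ => ?_) (fun k _ => ?_) h1, Fintype.sum_sum_type]
  · simp only [Sum.elim_inl, Sum.elim_inr, hA, smul_add, add_smul, Finset.sum_add_distrib,
      sum_smul_sum_eq_sum_mulVec, two_mul]
    abel
  · cases k with
    | inl i => exact (ha i).lieD hX
    | inr i => exact ha i
  · cases k with
    | inl i => exact hG i
    | inr i => exact hX.ad (hG i)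

/-- In a frame `G` with `[X, [X, G]] = G A₀ + [X, G] A₁`, horizontal vectors are combinations of
the vectors `[X, G] - G A₁ / 2`. -/
lemma IsRegular.exists_eq_of_mem_horizontal (hreg : IsRegular m X V) {x : M}
    (hG : IsLocalFrame V G x) {A₀ A₁ : Matrix (Fin m) (Fin m) ℝ}
    (hA : ∀ j, ad X (ad X (G j)) x = ∑ i, A₀ i j • G i x + ∑ i, A₁ i j • ad X (G i) x)
    {w : TangentSpace 𝓘(ℝ, E) x} (hw : w ∈ horizontal X V x) :
    ∃ b : Fin m → ℝ, w = ∑ i, (-(1 / 2 : ℝ) • A₁.mulVec b) i • G i x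
      + ∑ i, b i • ad X (G i) x := by
  unfold horizontal at hw
  induction hw using Submodule.span_induction with
  | mem w hw =>
    obtain ⟨Y, hY, rfl⟩ := hw
    obtain ⟨a, ha, hYa⟩ := exists_coefficients hG hY.1
    refine ⟨fun j => a j x, ?_⟩
    have h1 := hY.2.self_of_nhds
    rw [← hG.2.self_of_nhds.2, Submodule.mem_span_range_iff_exists_fun] at h1
    obtain ⟨p, hp⟩ := h1
    have h2 := ad_ad_eq_sum (hreg.smooth x) ha hG.1 hYa hA
    rw [← hp] at h2
    -- Normality kills the [X, G]-component: 2Xa + A₁a = 0 at `x`.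
    have h3 := (eq_of_linearIndependent_sumElim (hreg.linearIndependent hG) (p := p) (q := 0)
      (by rw [← h2]; simp)).2
    rw [ad_eq_sum ha hG.1 hYa]
    congr 1
    refine Finset.sum_congr rfl fun i _ => ?_
    congr 1
    have h4 := congrFun h3 i
    simp only [Pi.zero_apply] at h4
    simp only [Pi.smul_apply, smul_eq_mul]
    linarith
  | zero => exact ⟨0, by simp⟩
  | add w₁ w₂ _ _ h₁ h₂ =>
    obtain ⟨b₁, rfl⟩ := h₁
    obtain ⟨b₂, rfl⟩ := h₂
    refine ⟨b₁ + b₂, ?_⟩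
    simp only [Matrix.mulVec_add, smul_add, Pi.add_apply, add_smul, Finset.sum_add_distrib]
    abel
  | smul r w _ h =>
    obtain ⟨b, rfl⟩ := h
    refine ⟨r • b, ?_⟩
    simp only [Matrix.mulVec_smul, smul_add, Finset.smul_sum, smul_smul, Pi.smul_apply,
      smul_eq_mul]
    congr 1
    refine Finset.sum_congr rfl fun i _ => ?_
    congr 1
    ring

end Frames

/-! ### Sections along an integral curve and the curvature identity. -/

section AlongCurve

open Set

variable {E : Type*} [NormedAddCommGroup E] [NormedSpace ℝ E]
  {M : Type*} [TopologicalSpace M] [ChartedSpace E M]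
  {m : ℕ} {X : VField E M} {V : Planes E M} {G : Fin m → VField E M}
  {c : ℝ → M} {T : ℝ} {t : ℝ}

/-- Along an integral curve of `X`, the time derivative is the derivative along `X`. -/
lemma hasDerivWithinAt_comp_integralCurve {s : Set ℝ} (hc : IsMIntegralCurveOn c X s)
    (ht : t ∈ s) {f : M → ℝ} (hf : MDifferentiableAt 𝓘(ℝ, E) 𝓘(ℝ, ℝ) f (c t)) :
    HasDerivWithinAt (fun s => f (c s)) (lieD X f (c t)) s t := by
  have h1 := hf.hasMFDerivAt.comp_hasMFDerivWithinAt t (hc t ht)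
  -- All tangent spaces are `E` by definition; naming `D` and `v` over `E` states the claim without
  -- their base points.
  have h2 (D : E →L[ℝ] ℝ) (hD : D = mfderiv 𝓘(ℝ, E) 𝓘(ℝ, ℝ) f (c t)) (v : E) (hv : v = X (c t)) :
      HasDerivWithinAt (fun s => f (c s)) (D v) s t := by
    subst hD hv
    have h3 := hasMFDerivWithinAt_iff_hasFDerivWithinAt.1 h1
    rw [hasDerivWithinAt_iff_hasFDerivWithinAt]
    refine HasFDerivWithinAt.congr_fderiv h3 ?_
    ext
    change mfderiv 𝓘(ℝ, E) 𝓘(ℝ, ℝ) f (c t) ((1 : ℝ) • X (c t))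
      = (1 : ℝ) • mfderiv 𝓘(ℝ, E) 𝓘(ℝ, ℝ) f (c t) (X (c t))
    rw [map_smul]
  exact h2 _ rfl _ rfl

/-- Along `c` the derivative in the direction X is a time derivative, and derivatives within [0, T]
are unique even at the endpoints since T > 0. -/
lemma lieD_congr_along (hT : 0 < T) (hc : IsMIntegralCurveOn c X (Icc 0 T)) (ht : t ∈ Icc 0 T)
    {f g : M → ℝ} (hf : MDifferentiableAt 𝓘(ℝ, E) 𝓘(ℝ, ℝ) f (c t))
    (hg : MDifferentiableAt 𝓘(ℝ, E) 𝓘(ℝ, ℝ) g (c t))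
    (hfg : ∀ᶠ s in 𝓝[Icc 0 T] t, f (c s) = g (c s)) : lieD X f (c t) = lieD X g (c t) := by
  have h1 := hasDerivWithinAt_comp_integralCurve hc ht hf
  have h2 := (hasDerivWithinAt_comp_integralCurve hc ht hg).congr_of_eventuallyEq hfg
    (hfg.self_of_nhdsWithin ht)
  exact (uniqueDiffOn_Icc hT t ht).eq_deriv _ h1 h2

lemma IsMIntegralCurveOn.eventually_along {s : Set ℝ} (hc : IsMIntegralCurveOn c X s)
    (ht : t ∈ s) {p : M → Prop} (hp : ∀ᶠ y in 𝓝 (c t), p y) : ∀ᶠ s in 𝓝[s] t, p (c s) :=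
  (hc.continuousWithinAt ht).eventually hp

variable [IsManifold 𝓘(ℝ, E) ∞ M]

lemma Extends.eventually (hc : IsMIntegralCurveOn c X (Icc 0 T)) (ht : t ∈ Icc 0 T)
    {W : (s : ℝ) → TangentSpace 𝓘(ℝ, E) (c s)} {Y : VField E M} (hY : Extends V c T W t Y) :
    ∀ᶠ s in 𝓝[Icc 0 T] t, Extends V c T W s Y := by
  filter_upwards [IsMIntegralCurveOn.eventually_along hc ht hY.1.eventually,
    eventually_eventually_nhdsWithin.2 hY.2] with s h1 h2
  exact ⟨h1, h2⟩

variable [FiniteDimensional ℝ E]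

/-- The bracket of `X` with a section of `V` depends, along an integral curve, only on the
restriction of the section to the curve. -/
lemma IsRegular.ad_congr_along (hreg : IsRegular m X V) (hT : 0 < T)
    (hc : IsMIntegralCurveOn c X (Icc 0 T)) (ht : t ∈ Icc 0 T)
    {W : (s : ℝ) → TangentSpace 𝓘(ℝ, E) (c s)} {Y Y' : VField E M}
    (hY : Extends V c T W t Y) (hY' : Extends V c T W t Y') :
    ad X Y (c t) = ad X Y' (c t) := by
  obtain ⟨G, hG⟩ := hreg.distribution (c t)
  obtain ⟨a, ha, hYa⟩ := exists_coefficients hG hY.1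
  obtain ⟨a', ha', hYa'⟩ := exists_coefficients hG hY'.1
  have hev : ∀ᶠ s in 𝓝[Icc 0 T] t, ∀ i, a i (c s) = a' i (c s) := by
    filter_upwards [IsMIntegralCurveOn.eventually_along hc ht hYa,
      IsMIntegralCurveOn.eventually_along hc ht hYa',
      IsMIntegralCurveOn.eventually_along hc ht hG.2, hY.2, hY'.2] with s h1 h2 h3 h4 h5
    rw [h4] at h1
    rw [h5, h1] at h2
    have := linearIndependent_iff_injective_fintypeLinearCombination.1 h3.1
      (a₁ := fun i => a i (c s)) (a₂ := fun i => a' i (c s)) h2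
    exact congrFun this
  rw [ad_eq_sum ha hG.1 hYa, ad_eq_sum ha' hG.1 hYa']
  have h0 := hev.self_of_nhdsWithin ht
  congr 1
  · refine Finset.sum_congr rfl fun i _ => ?_
    rw [lieD_congr_along hT hc ht (ha i).mdifferentiableAt (ha' i).mdifferentiableAt
      (hev.mono fun s hs => hs i)]
  · exact Finset.sum_congr rfl fun i _ => by rw [h0 i]

/-- For a section of `V` which is parallel along `c`, the second bracket with `X` is minus the
curvature. -/
lemma IsRegular.ad_ad_eq_neg_curvature (hreg : IsRegular m X V) (hT : 0 < T)
    (hc : IsMIntegralCurveOn c X (Icc 0 T)) (ht : t ∈ Icc 0 T) {Y : VField E M}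
    (hY : IsLocalSection V Y (c t))
    (hhor : ∀ᶠ s in 𝓝[Icc 0 T] t, ad X Y (c s) ∈ horizontal X V (c s))
    {w : TangentSpace 𝓘(ℝ, E) (c t)} (hw : CurvatureEq m X V (c t) (Y (c t)) w) :
    ad X (ad X Y) (c t) = -w := by
  -- The computation runs in whichever frame witnesses the curvature relation; horizontality refers
  -- to no frame, so no change of frame is needed.
  obtain ⟨G, hG, K, ⟨H₀, H₁, hsm, hH, rfl⟩, b, hb, rfl⟩ := hw
  obtain ⟨a, ha, hYa⟩ := exists_coefficients hG hY
  have hab : (fun i => a i (c t)) = b := by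
    have h1 := hYa.self_of_nhds
    rw [hb] at h1
    exact linearIndependent_iff_injective_fintypeLinearCombination.1 hG.2.self_of_nhds.1 h1.symm
  have hsm₁ : ∀ i j, SmoothFunNear E (fun z => H₁ z i j) (c t) := fun i j =>
    hsm.mono fun y hy => (hy i j).2
  -- the coefficients of `Y` satisfy `X a = - H₁ a / 2` along `c`
  have hder : ∀ᶠ s in 𝓝[Icc 0 T] t, ∀ i,
      lieD X (a i) (c s) = -(1 / 2) * ∑ j, H₁ (c s) i j * a j (c s) := by
    filter_upwards [hhor, IsMIntegralCurveOn.eventually_along hc ht hG.eventually,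
      IsMIntegralCurveOn.eventually_along hc ht hH,
      IsMIntegralCurveOn.eventually_along hc ht
        (Filter.eventually_all.2 fun i => (ha i).eventually),
      IsMIntegralCurveOn.eventually_along hc ht (eventually_eventually_nhds.2 hYa)]
      with s h1 h2 h3 h4 h5
    obtain ⟨q, hq⟩ := hreg.exists_eq_of_mem_horizontal h2 h3 h1
    rw [ad_eq_sum h4 h2.1 h5] at hq
    obtain ⟨e1, e2⟩ := eq_of_linearIndependent_sumElim (hreg.linearIndependent h2) hq
    intro i
    rw [← e2] at e1
    have := congrFun e1 i
    simpa [Matrix.mulVec, dotProduct] using this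
  have hd0 := hder.self_of_nhdsWithin ht
  have hmd : ∀ i j, MDifferentiableAt 𝓘(ℝ, E) 𝓘(ℝ, ℝ) (fun z => H₁ z i j) (c t) :=
    fun i j => (hsm₁ i j).mdifferentiableAt
  have hma : ∀ j, MDifferentiableAt 𝓘(ℝ, E) 𝓘(ℝ, ℝ) (a j) (c t) :=
    fun j => (ha j).mdifferentiableAt
  -- The relation Xa = -H₁a/2 is known only on the curve, so it is differentiated in time, where
  -- both sides are functions of the parameter.
  have hdd : ∀ i, lieD X (lieD X (a i)) (c t) = -(1 / 2) * ∑ j,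
      (lieD X (fun z => H₁ z i j) (c t) * a j (c t) + H₁ (c t) i j * lieD X (a j) (c t)) := by
    intro i
    have h1 := hasDerivWithinAt_comp_integralCurve hc ht
      ((ha i).lieD (hreg.smooth (c t))).mdifferentiableAt
    have h2 : HasDerivWithinAt (fun s => -(1 / 2) * ∑ j, H₁ (c s) i j * a j (c s))
        (-(1 / 2) * ∑ j, (lieD X (fun z => H₁ z i j) (c t) * a j (c t)
          + H₁ (c t) i j * lieD X (a j) (c t))) (Icc 0 T) t :=
      (HasDerivWithinAt.fun_sum fun j _ =>
        (hasDerivWithinAt_comp_integralCurve hc ht (hmd i j)).mul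
          (hasDerivWithinAt_comp_integralCurve hc ht (hma j))).const_mul _
    exact (uniqueDiffOn_Icc hT t ht).eq_deriv _ h1
      (h2.congr_of_eventuallyEq (hder.mono fun s hs => hs i) (hd0 i))
  rw [ad_ad_eq_sum (hreg.smooth _) ha hG.1 hYa hH.self_of_nhds, hab]
  have hb' : ∀ j, a j (c t) = b j := fun j => congrFun hab j
  simp only [hb'] at hd0 hdd
  have hda : (fun j => lieD X (a j) (c t)) = -(1 / 2 : ℝ) • (H₁ (c t)).mulVec b := by
    funext i
    rw [hd0 i]
    rfl
  have hsnd : ∀ i, 2 * lieD X (a i) (c t) + (H₁ (c t)).mulVec b i = 0 := fun i => by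
    rw [hd0 i]
    simp only [Matrix.mulVec, dotProduct]
    ring
  have hfst : ∀ i, lieD X (lieD X (a i)) (c t) = -(1 / 2) * (Matrix.of
      (fun i j => lieD X (fun z => H₁ z i j) (c t))).mulVec b i
      + 1 / 4 * (H₁ (c t) * H₁ (c t)).mulVec b i := fun i => by
    have e : (H₁ (c t)).mulVec (fun j => lieD X (a j) (c t)) i
        = -(1 / 2) * (H₁ (c t) * H₁ (c t)).mulVec b i := by
      rw [hda, Matrix.mulVec_smul, Matrix.mulVec_mulVec]; rfl
    rw [hdd i, Finset.sum_add_distrib, mul_add]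
    change _ + -(1 / 2) * (H₁ (c t)).mulVec (fun j => lieD X (a j) (c t)) i = _
    rw [e]
    simp only [Matrix.mulVec, dotProduct, Matrix.of_apply]
    ring
  simp only [hsnd, zero_smul, Finset.sum_const_zero, add_zero]
  rw [← Finset.sum_neg_distrib]
  refine Finset.sum_congr rfl fun i _ => ?_
  rw [← neg_smul, hfst i]
  congr 1
  simp only [Matrix.sub_mulVec, Matrix.add_mulVec, Matrix.neg_mulVec, Matrix.smul_mulVec,
    Pi.sub_apply, Pi.add_apply, Pi.neg_apply, Pi.smul_apply, smul_eq_mul]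
  change _ = -(-(H₀ (c t)).mulVec b i + 1 / 2 * (Matrix.of
      (fun i j => lieD X (fun z => H₁ z i j) (c t))).mulVec b i - _)
  ring

/-- A parallel section `W` of eigenvectors of the curvature satisfies `[X, [X, W]] = -lam W`. -/
lemma IsRegular.ad_ad_eq_neg_smul (hreg : IsRegular m X V) (hT : 0 < T)
    (hc : IsMIntegralCurveOn c X (Icc 0 T)) {W : (s : ℝ) → TangentSpace 𝓘(ℝ, E) (c s)}
    {lam : ℝ → ℝ} (hW : ∀ t ∈ Icc 0 T, CovDerivEq X V c T W t 0)
    (hcurv : ∀ t ∈ Icc 0 T, CurvatureEq m X V (c t) (W t) (lam t • W t))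
    (ht : t ∈ Icc 0 T) {Y : VField E M} (hY : Extends V c T W t Y) :
    ad X (ad X Y) (c t) = -(lam t • W t) := by
  refine hreg.ad_ad_eq_neg_curvature hT hc ht hY.1 ?_ ?_
  · filter_upwards [hY.eventually hc ht, self_mem_nhdsWithin] with s hs hsT
    obtain ⟨-, Y', hY', hmem⟩ := hW s hsT
    -- Parallelism at each time `s` comes with its own extension `Y'`; the bracket on the curve does
    -- not depend on this choice.
    rw [hreg.ad_congr_along hT hc hsT hs hY']
    simpa using hmem
  · rw [hY.2.self_of_nhdsWithin ht]
    exact hcurv t ht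

end AlongCurve

/-! ### Integral curves and the short time flow on the manifold. -/

section Flow

open Set

variable {E : Type*} [NormedAddCommGroup E] [NormedSpace ℝ E]
  {M : Type*} [TopologicalSpace M] [ChartedSpace E M] [IsManifold 𝓘(ℝ, E) ∞ M]
  {X : VField E M}

/-- An integral curve read in a chart. -/
lemma hasDerivWithinAt_chart_integralCurve {γ : ℝ → M} {s : Set ℝ} {t : ℝ} {p : M}
    (hγ : IsMIntegralCurveOn γ X s) (ht : t ∈ s) (hsrc : γ t ∈ (extChartAt 𝓘(ℝ, E) p).source) :
    HasDerivWithinAt (fun u => extChartAt 𝓘(ℝ, E) p (γ u))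
      (chartField p X (extChartAt 𝓘(ℝ, E) p (γ t))) s t := by
  rw [chartField_apply X hsrc]
  have h1 := ((contMDiffAt_chart hsrc).mdifferentiableAt
    (by simp)).hasMFDerivAt.comp_hasMFDerivWithinAt t (hγ t ht)
  have h3 := hasMFDerivWithinAt_iff_hasFDerivWithinAt.1 h1
  rw [hasDerivWithinAt_iff_hasFDerivWithinAt]
  refine HasFDerivWithinAt.congr_fderiv h3 ?_
  ext
  change chartVec p (γ t) ((1 : ℝ) • X (γ t)) = (1 : ℝ) • chartVec p (γ t) (X (γ t))
  rw [map_smul]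

/-- A solution of the equation read in a chart is an integral curve. -/
lemma isMIntegralCurveOn_chart_symm {α : ℝ → E} {s : Set ℝ} {p : M}
    (hα : ∀ t ∈ s, α t ∈ (extChartAt 𝓘(ℝ, E) p).target ∧
      HasDerivWithinAt α (chartField p X (α t)) s t) :
    IsMIntegralCurveOn (fun t => (extChartAt 𝓘(ℝ, E) p).symm (α t)) X s := by
  intro t ht
  obtain ⟨hm, hd⟩ := hα t ht
  have h1 := ((contMDiffAt_chart_symm hm).mdifferentiableAt
    (by simp)).hasMFDerivAt.comp_hasMFDerivWithinAt t
    (hasMFDerivWithinAt_iff_hasFDerivWithinAt.2 hd.hasFDerivWithinAt)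
  rw [chartField_apply_of_mem_target X hm] at h1
  refine HasMFDerivWithinAt.congr_mfderiv h1 ?_
  ext
  have h2 := DFunLike.congr_fun (mfderiv_symm_comp_chartVec hm)
    (X ((extChartAt 𝓘(ℝ, E) p).symm (α t)))
  change mfderiv 𝓘(ℝ, E) 𝓘(ℝ, E) (extChartAt 𝓘(ℝ, E) p).symm (α t)
      ((1 : ℝ) • (chartVec (E := E) p ((extChartAt 𝓘(ℝ, E) p).symm (α t))
      (X ((extChartAt 𝓘(ℝ, E) p).symm (α t))))) = (1 : ℝ) • X ((extChartAt 𝓘(ℝ, E) p).symm (α t))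
  rw [one_smul, one_smul]
  exact h2

variable [CompleteSpace E]

/-- Integral curves of a smooth vector field on `[0, τ]` are determined by their initial point. -/
lemma integralCurve_eqOn [T2Space M] (hX : ∀ x, SmoothNear X x) {γ γ' : ℝ → M} {τ : ℝ}
    (hγ : IsMIntegralCurveOn γ X (Icc 0 τ)) (hγ' : IsMIntegralCurveOn γ' X (Icc 0 τ))
    (h0 : γ 0 = γ' 0) : EqOn γ γ' (Icc 0 τ) := by
  -- Continuity argument: the coincidence set is closed as `M` is Hausdorff, and uniqueness in a
  -- chart pushes it to the right.
  have hclosed : IsClosed ({s | γ s = γ' s} ∩ Icc 0 τ) := by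
    rw [inter_comm]
    exact (hγ.continuousOn.prodMk hγ'.continuousOn).preimage_isClosed_of_isClosed isClosed_Icc
      isClosed_diagonal
  refine hclosed.Icc_subset_of_forall_exists_gt h0 ?_
  rintro s ⟨hs : γ s = γ' s, hsI⟩ y (hy : s < y)
  have hsI' := Ico_subset_Icc_self hsI
  set p := γ s with hp
  have hps : p ∈ (extChartAt 𝓘(ℝ, E) p).source := mem_extChartAt_source p
  obtain ⟨K, U, hU, hK⟩ := ((contDiffAt_chartField hps (hX p).self_of_nhds).of_le
    (show (1 : ℕ∞ω) ≤ ∞ from by simp)).exists_lipschitzOnWith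
  have hN : ∀ᶠ x in 𝓝 p, x ∈ (extChartAt 𝓘(ℝ, E) p).source ∧ extChartAt 𝓘(ℝ, E) p x ∈ U :=
    Filter.Eventually.and (extChartAt_source_mem_nhds p)
      ((continuousAt_extChartAt p).eventually hU)
  have hev : ∀ᶠ u in 𝓝[≥] s, u ∈ Icc 0 τ ∧
      (γ u ∈ (extChartAt 𝓘(ℝ, E) p).source ∧ extChartAt 𝓘(ℝ, E) p (γ u) ∈ U) ∧
      (γ' u ∈ (extChartAt 𝓘(ℝ, E) p).source ∧ extChartAt 𝓘(ℝ, E) p (γ' u) ∈ U) ∧ u < y := by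
    have hle : 𝓝[≥] s ≤ 𝓝[Icc 0 τ] s := nhdsWithin_le_of_mem (Icc_mem_nhdsGE_of_mem hsI)
    refine Filter.Eventually.and (Icc_mem_nhdsGE_of_mem hsI) (.and ?_ (.and ?_ ?_))
    · exact (hγ.continuousWithinAt hsI').mono_left hle |>.eventually hN
    · rw [hs] at hN
      have h1 := ((hγ'.continuousWithinAt hsI').mono_left hle).eventually hN
      rwa [← hs] at h1
    · exact nhdsWithin_le_nhds (Iio_mem_nhds hy)
  obtain ⟨b, hb : s < b, hbsub⟩ := mem_nhdsGE_iff_exists_Icc_subset.1 hev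
  have key := ODE_solution_unique_of_mem_Icc_right (a := s) (b := b)
    (v := fun _ => chartField p X) (s := fun _ => U) (K := K)
    (f := fun u => extChartAt 𝓘(ℝ, E) p (γ u)) (g := fun u => extChartAt 𝓘(ℝ, E) p (γ' u))
    (fun _ _ => hK)
    (fun u hu => ((hasDerivWithinAt_chart_integralCurve hγ (hbsub hu).1
      (hbsub hu).2.1.1).mono fun v hv => (hbsub hv).1).continuousWithinAt)
    (fun u hu => ((hasDerivWithinAt_chart_integralCurve hγ (hbsub (Ico_subset_Icc_self hu)).1
      (hbsub (Ico_subset_Icc_self hu)).2.1.1).mono fun v hv => (hbsub hv).1).mono_of_mem_nhdsWithin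
        (Icc_mem_nhdsGE_of_mem hu))
    (fun u hu => (hbsub (Ico_subset_Icc_self hu)).2.1.2)
    (fun u hu => ((hasDerivWithinAt_chart_integralCurve hγ' (hbsub hu).1
      (hbsub hu).2.2.1.1).mono fun v hv => (hbsub hv).1).continuousWithinAt)
    (fun u hu => ((hasDerivWithinAt_chart_integralCurve hγ' (hbsub (Ico_subset_Icc_self hu)).1
      (hbsub (Ico_subset_Icc_self hu)).2.2.1.1).mono fun v hv =>
        (hbsub hv).1).mono_of_mem_nhdsWithin (Icc_mem_nhdsGE_of_mem hu))
    (fun u hu => (hbsub (Ico_subset_Icc_self hu)).2.2.1.2)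
    (congrArg (extChartAt 𝓘(ℝ, E) p) hs)
  have hbm := hbsub ⟨hb.le, le_rfl⟩
  exact ⟨b, (extChartAt 𝓘(ℝ, E) p).injOn hbm.2.1.1 hbm.2.2.1.1 (key ⟨hb.le, le_rfl⟩),
    hb, hbm.2.2.2.le⟩

omit [IsManifold 𝓘(ℝ, E) ∞ M] [CompleteSpace E] in
/-- Concatenation of integral curves. -/
lemma FlowsTo.trans {a b : ℝ} (ha : 0 ≤ a) (hb : 0 ≤ b) {x y z : M} (h₁ : FlowsTo X a x y)
    (h₂ : FlowsTo X b y z) : FlowsTo X (a + b) x z := by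
  obtain ⟨γ₁, hγ₁, rfl, rfl⟩ := h₁
  obtain ⟨γ₂, hγ₂, h₂0, rfl⟩ := h₂
  set γ : ℝ → M := fun s => if s ≤ a then γ₁ s else γ₂ (s - a) with hγ
  have e₁ : ∀ s ∈ Icc 0 a, γ s = γ₁ s := fun s hs => if_pos hs.2
  have e₂ : ∀ s ∈ Icc a (a + b), γ s = γ₂ (s - a) := fun s hs => by
    rcases hs.1.eq_or_lt with rfl | h
    · simp [hγ, h₂0]
    · exact if_neg (not_le.2 h)
  have c₁ : IsMIntegralCurveOn γ X (Icc 0 a) := fun s hs => by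
    have := (hγ₁ s hs).congr_of_eventuallyEq
      (Filter.eventuallyEq_of_mem self_mem_nhdsWithin e₁) (e₁ s hs)
    rwa [← e₁ s hs] at this
  have c₂ : IsMIntegralCurveOn γ X (Icc a (a + b)) := fun s hs => by
    have hsub : {t | t + -a ∈ Icc 0 b} = Icc a (a + b) := by
      ext t; simp only [mem_ofPred_eq, mem_Icc]; constructor <;> rintro ⟨h, h'⟩ <;>
        constructor <;> linarith
    have h3 := hγ₂.comp_add (-a)
    rw [hsub] at h3
    have := (h3 s hs).congr_of_eventuallyEq
      (Filter.eventuallyEq_of_mem self_mem_nhdsWithin e₂) (e₂ s hs)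
    have e₃ : (γ₂ ∘ fun x => x + -a) s = γ s := (e₂ s hs).symm
    rwa [e₃] at this
  refine ⟨γ, fun s hs => ?_, e₁ 0 ⟨le_rfl, ha⟩, ?_⟩
  · rcases lt_trichotomy s a with h | h | h
    · refine (c₁ s ⟨hs.1, h.le⟩).mono_of_mem_nhdsWithin ?_
      filter_upwards [self_mem_nhdsWithin, nhdsWithin_le_nhds (Iio_mem_nhds h)] with u hu hu'
      exact ⟨hu.1, le_of_lt hu'⟩
    · rw [← Icc_union_Icc_eq_Icc ha (by linarith : a ≤ a + b)]
      exact (c₁ s ⟨hs.1, h.le⟩).union (c₂ s ⟨h.ge, hs.2⟩)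
    · refine (c₂ s ⟨h.le, hs.2⟩).mono_of_mem_nhdsWithin ?_
      filter_upwards [self_mem_nhdsWithin, nhdsWithin_le_nhds (Ioi_mem_nhds h)] with u hu hu'
      exact ⟨le_of_lt hu', hu.2⟩
  · rw [e₂ (a + b) ⟨by linarith, le_rfl⟩, add_sub_cancel_left]

/-- Uniqueness of integral curves makes the choice in `flowMap` harmless: any integral curve
computes it. -/
lemma flowMap_eq [T2Space M] (hX : ∀ x, SmoothNear X x) {t : ℝ} (ht : 0 ≤ t) {x y : M}
    (h : FlowsTo X t x y) : flowMap X t x = y := by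
  have hex : ∃ y, FlowsTo X t x y := ⟨y, h⟩
  rw [flowMap, dif_pos hex]
  obtain ⟨γ, hγ, h0, h1⟩ := hex.choose_spec
  obtain ⟨γ', hγ', h0', h1'⟩ := h
  rw [← h1, ← h1']
  exact integralCurve_eqOn hX hγ hγ' (h0.trans h0'.symm) ⟨ht, le_rfl⟩

/-- Short time flow near a point: it is differentiable, and its derivative transports the vector
fields along integral curves which solve the linearised equation. -/
lemma exists_hasMFDerivAt_flowMap [T2Space M] (hX : ∀ x, SmoothNear X x) (p : M) :
    ∃ ε > 0, ∃ N ∈ 𝓝 p, ∀ x ∈ N, ∀ τ ∈ Icc 0 ε, (∃ y, FlowsTo X τ x y) ∧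
      ∀ γ : ℝ → M, IsMIntegralCurveOn γ X (Icc 0 τ) → γ 0 = x →
      ∃ A : E →L[ℝ] E, HasMFDerivAt 𝓘(ℝ, E) 𝓘(ℝ, E) (flowMap X τ) x A ∧
        ∀ J : (s : ℝ) → TangentSpace 𝓘(ℝ, E) (γ s),
          (∀ t ∈ Icc 0 τ, HasDerivWithinAt (fun s => chartVec p (γ s) (J s))
            (fderiv ℝ (chartField p X) (extChartAt 𝓘(ℝ, E) p (γ t)) (chartVec p (γ t) (J t)))
            (Icc 0 τ) t) → A (J 0 : E) = (J τ : E) := by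
  have hps : p ∈ (extChartAt 𝓘(ℝ, E) p).source := mem_extChartAt_source p
  obtain ⟨ε, hε, ρ, hρ, α, hα, hD⟩ := exists_localFlow
    ((contDiffAt_chartField hps (hX p).self_of_nhds).of_le
      (show (2 : ℕ∞ω) ≤ ∞ from ENat.LEInfty.out)) (mem_target_nhds hps)
  refine ⟨ε, hε, {x | x ∈ (extChartAt 𝓘(ℝ, E) p).source ∧
    extChartAt 𝓘(ℝ, E) p x ∈ Metric.ball (extChartAt 𝓘(ℝ, E) p p) ρ}, ?_, ?_⟩
  · exact Filter.Eventually.and (extChartAt_source_mem_nhds p)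
      ((continuousAt_extChartAt p).eventually (Metric.ball_mem_nhds _ hρ))
  rintro x ⟨hxs, hxb⟩ τ hτ
  have hτs : Icc 0 τ ⊆ Icc 0 ε := Icc_subset_Icc_right hτ.2
  have hτm : τ ∈ Icc 0 τ := ⟨hτ.1, le_rfl⟩
  have hcurve : ∀ x' ∈ (extChartAt 𝓘(ℝ, E) p).source,
      extChartAt 𝓘(ℝ, E) p x' ∈ Metric.ball (extChartAt 𝓘(ℝ, E) p p) ρ →
      IsMIntegralCurveOn (fun t => (extChartAt 𝓘(ℝ, E) p).symm (α (extChartAt 𝓘(ℝ, E) p x') t)) X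
        (Icc 0 τ) ∧ (extChartAt 𝓘(ℝ, E) p).symm (α (extChartAt 𝓘(ℝ, E) p x') 0) = x' := by
    intro x' h1 h2
    obtain ⟨h3, h4⟩ := hα _ h2
    refine ⟨isMIntegralCurveOn_chart_symm fun t ht => ⟨(h4 t (hτs ht)).1,
      (h4 t (hτs ht)).2.mono hτs⟩, ?_⟩
    rw [h3, (extChartAt 𝓘(ℝ, E) p).left_inv h1]
  have hflow : ∀ x' ∈ (extChartAt 𝓘(ℝ, E) p).source,
      extChartAt 𝓘(ℝ, E) p x' ∈ Metric.ball (extChartAt 𝓘(ℝ, E) p p) ρ →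
      FlowsTo X τ x' ((extChartAt 𝓘(ℝ, E) p).symm (α (extChartAt 𝓘(ℝ, E) p x') τ)) :=
    fun x' h1 h2 => ⟨_, (hcurve x' h1 h2).1, (hcurve x' h1 h2).2, rfl⟩
  refine ⟨⟨_, hflow x hxs hxb⟩, fun γ hγ hγ0 => ?_⟩
  subst hγ0
  have hγα : ∀ t ∈ Icc 0 τ, γ t = (extChartAt 𝓘(ℝ, E) p).symm (α (extChartAt 𝓘(ℝ, E) p (γ 0)) t) :=
    integralCurve_eqOn hX hγ (hcurve (γ 0) hxs hxb).1 (hcurve (γ 0) hxs hxb).2.symm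
  have htar : ∀ t ∈ Icc 0 τ, α (extChartAt 𝓘(ℝ, E) p (γ 0)) t ∈ (extChartAt 𝓘(ℝ, E) p).target :=
    fun t ht => ((hα _ hxb).2 t (hτs ht)).1
  have hφγ : ∀ t ∈ Icc 0 τ, extChartAt 𝓘(ℝ, E) p (γ t) = α (extChartAt 𝓘(ℝ, E) p (γ 0)) t :=
    fun t ht => by rw [hγα t ht, (extChartAt 𝓘(ℝ, E) p).right_inv (htar t ht)]
  obtain ⟨A, hA, hAJ⟩ := hD _ hxb τ hτ
  have hsymm := ((contMDiffAt_chart_symm (htar τ hτm)).mdifferentiableAt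
    (by simp)).hasMFDerivAt
  have hchart := ((contMDiffAt_chart hxs).mdifferentiableAt (by simp)).hasMFDerivAt
  have hcomp := (HasMFDerivAt.comp (γ 0) (I' := 𝓘(ℝ, E)) hsymm
    (HasMFDerivAt.comp (γ 0) (I' := 𝓘(ℝ, E)) (hasMFDerivAt_iff_hasFDerivAt.2 hA) hchart))
  have heq : flowMap X τ =ᶠ[𝓝 (γ 0)] fun x' =>
      (extChartAt 𝓘(ℝ, E) p).symm (α (extChartAt 𝓘(ℝ, E) p x') τ) := by
    have hN : ∀ᶠ x' in 𝓝 (γ 0), extChartAt 𝓘(ℝ, E) p x' ∈ Metric.ball (extChartAt 𝓘(ℝ, E) p p) ρ :=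
      (continuousAt_extChartAt' hxs).eventually (Metric.isOpen_ball.mem_nhds hxb)
    filter_upwards [hN, (isOpen_extChartAt_source p).mem_nhds hxs] with x' h1 h2
    exact flowMap_eq hX hτ.1 (hflow x' h2 h1)
  refine ⟨_, hcomp.congr_of_eventuallyEq heq, fun J hJ => ?_⟩
  have h1 := hAJ (fun s => chartVec p (γ s) (J s)) fun t ht => by
    rw [← hφγ t ht]; exact hJ t ht
  have h2 := DFunLike.congr_fun (mfderiv_symm_comp_chartVec (htar τ hτm))
    (J τ : E)
  rw [← hγα τ hτm] at h2
  change mfderiv 𝓘(ℝ, E) 𝓘(ℝ, E) (extChartAt 𝓘(ℝ, E) p).symm (α (extChartAt 𝓘(ℝ, E) p (γ 0)) τ)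
    (A (chartVec (E := E) p (γ 0) (J 0 : E))) = _
  refine Eq.trans ?_ h2
  exact congrArg (mfderiv 𝓘(ℝ, E) 𝓘(ℝ, E) (extChartAt 𝓘(ℝ, E) p).symm
    (α (extChartAt 𝓘(ℝ, E) p (γ 0)) τ)) h1

end Flow

/-! ### Transport of Jacobi fields by the flow, and conjugate vectors. -/

section Transport

open Set

variable {E : Type*} [NormedAddCommGroup E] [NormedSpace ℝ E]
  {M : Type*} [TopologicalSpace M] [ChartedSpace E M] [IsManifold 𝓘(ℝ, E) ∞ M]
  {X : VField E M} {V : Planes E M} {c : ℝ → M} {T : ℝ}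

/-- The field `J` along the integral curve `c` of `X` has vanishing Lie derivative along `X`: read
in charts, it solves the linearised equation. -/
def IsLieParallel (X : VField E M) (c : ℝ → M) (T : ℝ)
    (J : (s : ℝ) → TangentSpace 𝓘(ℝ, E) (c s)) : Prop :=
  ∀ t ∈ Icc 0 T, ∀ᶠ s in 𝓝[Icc 0 T] t,
    HasDerivWithinAt (fun u => chartVec (c t) (c u) (J u))
      (fderiv ℝ (chartField (c t) X) (extChartAt 𝓘(ℝ, E) (c t) (c s))
        (chartVec (c t) (c s) (J s))) (Icc 0 T) s

/-- The flow of `X` transports Lie parallel fields along `c`. -/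
theorem exists_hasMFDerivAt_flowMap_of_isLieParallel [CompleteSpace E] [T2Space M]
    (hX : ∀ x, SmoothNear X x) (hc : IsMIntegralCurveOn c X (Icc 0 T))
    {J : (s : ℝ) → TangentSpace 𝓘(ℝ, E) (c s)} (hJ : IsLieParallel X c T J) {t : ℝ}
    (ht : t ∈ Icc 0 T) :
    ∃ A : E →L[ℝ] E, HasMFDerivAt 𝓘(ℝ, E) 𝓘(ℝ, E) (flowMap X t) (c 0) A ∧
      A (J 0 : E) = (J t : E) := by
  have htT : Icc 0 t ⊆ Icc 0 T := Icc_subset_Icc_right ht.2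
  have hflow : ∀ s ∈ Icc 0 T, FlowsTo X s (c 0) (c s) := fun s hs =>
    ⟨c, hc.mono (Icc_subset_Icc_right hs.2), rfl, rfl⟩
  -- `P` also records that the flow exists near `c 0`; otherwise `flowMap` could take its default
  -- value there and the composition law would fail.
  set P : ℝ → Prop := fun s => (∀ᶠ x in 𝓝 (c 0), ∃ y, FlowsTo X s x y) ∧
    ∃ A : E →L[ℝ] E, HasMFDerivAt 𝓘(ℝ, E) 𝓘(ℝ, E) (flowMap X s) (c 0) A ∧
      A (J 0 : E) = (J s : E) with hP
  suffices P t from this.2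
  have hP0 : P 0 := by
    have h0 : ∀ x, FlowsTo X 0 x x := fun x => by
      obtain ⟨ε, hε, N, hN, h⟩ := exists_hasMFDerivAt_flowMap hX x
      obtain ⟨y, γ, hγ, h1, h2⟩ := (h x (mem_of_mem_nhds hN) 0 ⟨le_rfl, hε.le⟩).1
      exact ⟨γ, hγ, h1, h1⟩
    refine ⟨Filter.Eventually.of_forall fun x => ⟨x, h0 x⟩, ContinuousLinearMap.id ℝ E, ?_, rfl⟩
    have : flowMap X 0 = id := funext fun x => flowMap_eq hX le_rfl (h0 x)
    rw [this]
    exact hasMFDerivAt_id (c 0)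
  have hloc : ∀ t₀ ∈ Icc 0 T, ∃ δ > 0, ∀ s ∈ Icc 0 T, ∀ s' ∈ Icc 0 T, s ≤ s' →
      |s - t₀| < δ → |s' - t₀| < δ → P s → P s' := by
    intro t₀ ht₀
    obtain ⟨ε, hε, N, hN, hstep⟩ := exists_hasMFDerivAt_flowMap hX (c t₀)
    obtain ⟨δ, hδ, hball⟩ := Metric.mem_nhdsWithin_iff.1
      (Filter.inter_mem ((hc.continuousWithinAt ht₀) (eventually_mem_nhds_iff.2 hN)) (hJ t₀ ht₀))
    -- `δ` keeps [s, s'] where the chart at `c t₀` applies; `ε / 2` on each side of `t₀` makes s' -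
    -- s at most ε.
    refine ⟨min δ (ε / 2), by positivity, fun s hs s' hs' hss h1 h2 hPs => ?_⟩
    obtain ⟨hex, A, hA, hAJ⟩ := hPs
    have hin : ∀ u ∈ Icc s s', u ∈ Metric.ball t₀ δ ∩ Icc 0 T := fun u hu => by
      refine ⟨?_, hs.1.trans hu.1, hu.2.trans hs'.2⟩
      rw [Metric.mem_ball, Real.dist_eq]
      rw [abs_lt] at h1 h2 ⊢
      have := min_le_left δ (ε / 2)
      constructor <;> linarith [hu.1, hu.2]
    have hτ : s' - s ∈ Icc 0 ε := by
      rw [abs_lt] at h1 h2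
      have := min_le_right δ (ε / 2)
      constructor <;> linarith
    have hNs : N ∈ 𝓝 (c s) := (hball (hin s ⟨le_rfl, hss⟩)).1
    have hfs : flowMap X s (c 0) = c s := flowMap_eq hX hs.1 (hflow s hs)
    have hmaps : MapsTo (fun u => u + s) (Icc 0 (s' - s)) (Icc s s') := fun u hu =>
      ⟨by linarith [hu.1], by linarith [hu.2]⟩
    have hmapsT : MapsTo (fun u => u + s) (Icc 0 (s' - s)) (Icc 0 T) := fun u hu =>
      (hin _ (hmaps hu)).2
    obtain ⟨-, hB⟩ := hstep (c s) (mem_of_mem_nhds hNs) (s' - s) hτ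
    obtain ⟨B, hB, hBJ⟩ := hB (fun u => c (u + s)) ((hc.comp_add s).mono hmapsT) (by simp)
    have hBJ' := hBJ (fun u => J (u + s)) fun u hu => by
      have h3 : HasDerivWithinAt (fun u => chartVec (c t₀) (c u) (J u))
          (fderiv ℝ (chartField (c t₀) X) (extChartAt 𝓘(ℝ, E) (c t₀) (c (u + s)))
            (chartVec (c t₀) (c (u + s)) (J (u + s)))) (Icc 0 T) (u + s) :=
        (hball (hin _ (hmaps hu))).2
      have h4 := HasDerivWithinAt.scomp u h3 (hasDerivWithinAt_id u (Icc 0 (s' - s)) |>.add_const s)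
        hmapsT
      simpa [Function.comp_def] using! h4
    have hev : ∀ᶠ x in 𝓝 (c 0), (∃ y, FlowsTo X s x y) ∧ flowMap X s x ∈ N := by
      refine hex.and ?_
      have hcont := hA.continuousAt
      rw [ContinuousAt, hfs] at hcont
      exact hcont.eventually hNs
    have hcomp : ∀ᶠ x in 𝓝 (c 0), FlowsTo X s' x (flowMap X (s' - s) (flowMap X s x)) := by
      filter_upwards [hev] with x hx
      obtain ⟨⟨y, hy⟩, hxN⟩ := hx
      rw [flowMap_eq hX hs.1 hy] at hxN ⊢
      obtain ⟨⟨z, hz⟩, -⟩ := hstep y hxN (s' - s) hτ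
      rw [flowMap_eq hX hτ.1 hz]
      simpa using hy.trans hs.1 hτ.1 hz
    refine ⟨hcomp.mono fun x hx => ⟨_, hx⟩, B.comp A, ?_, ?_⟩
    · rw [← hfs] at hB
      exact (HasMFDerivAt.comp (c 0) hB hA).congr_of_eventuallyEq
        (hcomp.mono fun x hx => flowMap_eq hX hs'.1 hx)
    · have e1 : (J (0 + s) : E) = (J s : E) := by rw [zero_add]
      have e2 : (J (s' - s + s) : E) = (J s' : E) := by rw [sub_add_cancel]
      exact (congrArg B (hAJ.trans e1.symm)).trans (hBJ'.trans e2)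
  choose! δ hδ hδP using hloc
  -- A subdivision of [0, t] with each step inside one neighbourhood where `P` propagates forward.
  obtain ⟨u, hu0, humono, ⟨n, hn⟩, hu⟩ := exists_monotone_Icc_subset_open_cover_Icc ht.1
    (c := fun i : Icc (0 : ℝ) t => {s : Icc (0 : ℝ) t | |(s : ℝ) - i| < δ i})
    (fun i => isOpen_lt (by fun_prop) continuous_const)
    (fun i _ => mem_iUnion.2 ⟨i, by simpa using hδ i (htT i.2)⟩)
  have hind : ∀ k, P (u k) := by
    intro k
    induction k with
    | zero => rwa [hu0]
    | succ k ih =>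
      obtain ⟨i, hi⟩ := hu k
      have hle := humono (Nat.le_succ k)
      exact hδP i (htT i.2) _ (htT (u k).2) _ (htT (u (k + 1)).2) hle
        (hi ⟨le_rfl, hle⟩) (hi ⟨hle, le_rfl⟩) ih
  have := hind n
  rwa [hn n le_rfl] at this

variable [FiniteDimensional ℝ E] {m : ℕ}

/-- The eigenvalue of the curvature on a parallel section is continuous. -/
lemma IsRegular.continuousOn_eigenvalue (hreg : IsRegular m X V) (hT : 0 < T)
    (hc : IsMIntegralCurveOn c X (Icc 0 T)) {W : (s : ℝ) → TangentSpace 𝓘(ℝ, E) (c s)}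
    {lam : ℝ → ℝ} (hW0 : ∀ t ∈ Icc 0 T, W t ≠ 0)
    (hW : ∀ t ∈ Icc 0 T, CovDerivEq X V c T W t 0)
    (hcurv : ∀ t ∈ Icc 0 T, CurvatureEq m X V (c t) (W t) (lam t • W t)) :
    ContinuousOn lam (Icc 0 T) := by
  intro t ht
  obtain ⟨-, Y, hY, -⟩ := hW t ht
  have hsrc := mem_extChartAt_source (I := 𝓘(ℝ, E)) (c t)
  have hne : chartVec (E := E) (c t) (c t) (W t) ≠ 0 := fun h =>
    hW0 t ht ((map_eq_zero_iff _ (chartVec_injective hsrc)).1 h)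
  -- A functional nonzero on W(t) expresses λ near `t` as -g([X,[X,Y]]) / g(Y), a quotient of
  -- continuous functions.
  obtain ⟨g, hg⟩ := SeparatingDual.exists_ne_zero (R := ℝ) hne
  have hcont : ∀ {Z : VField E M}, SmoothNear Z (c t) → ContinuousWithinAt
      (fun s => g (chartField (c t) Z (extChartAt 𝓘(ℝ, E) (c t) (c s)))) (Icc 0 T) t := fun hZ =>
    g.continuous.continuousAt.comp_continuousWithinAt
      (ContinuousAt.comp_continuousWithinAt (g := chartField (c t) _)
        (contDiffAt_chartField hsrc hZ.self_of_nhds).continuousAt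
        ((continuousAt_extChartAt (c t)).comp_continuousWithinAt (hc.continuousWithinAt ht)))
  have hX := hreg.smooth (c t)
  have h1 := hcont hY.1.1
  have h2 := hcont (hX.ad (hX.ad hY.1.1))
  have hWt : Y (c t) = W t := hY.2.self_of_nhdsWithin ht
  have hg0 : g (chartField (c t) Y (extChartAt 𝓘(ℝ, E) (c t) (c t))) ≠ 0 := by
    rw [chartField_apply _ hsrc, hWt]
    exact hg
  have hq : ContinuousWithinAt (fun s =>
      -(g (chartField (c t) (ad X (ad X Y)) (extChartAt 𝓘(ℝ, E) (c t) (c s)))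
      / g (chartField (c t) Y (extChartAt 𝓘(ℝ, E) (c t) (c s))))) (Icc 0 T) t := by
    exact (h2.div h1 hg0).neg
  have hev : ∀ᶠ s in 𝓝[Icc 0 T] t, lam s =
      -(g (chartField (c t) (ad X (ad X Y)) (extChartAt 𝓘(ℝ, E) (c t) (c s)))
      / g (chartField (c t) Y (extChartAt 𝓘(ℝ, E) (c t) (c s)))) := by
    have hne' := h1.eventually_ne hg0
    filter_upwards [hne', hY.eventually hc ht, self_mem_nhdsWithin,
      IsMIntegralCurveOn.eventually_along hc ht (extChartAt_source_mem_nhds (I := 𝓘(ℝ, E)) (c t))]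
      with s h3 h4 h5 h6
    have h7 := hreg.ad_ad_eq_neg_smul hT hc hW hcurv h5 h4
    have h8 : Y (c s) = W s := h4.2.self_of_nhdsWithin h5
    rw [chartField_apply _ h6] at h3 ⊢
    rw [chartField_apply _ h6, h7, h8, map_neg, map_smul, map_neg, map_smul, smul_eq_mul]
    rw [h8] at h3
    field_simp
  exact hq.congr_of_eventuallyEq hev (hev.self_of_nhdsWithin ht)

/-- For a parallel section `W` of eigenvectors and a solution `y` of the scalar equation, the field
`y' W - y [X, W]` is Lie parallel. -/
lemma IsRegular.exists_isLieParallel (hreg : IsRegular m X V) (hT : 0 < T)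
    (hc : IsMIntegralCurveOn c X (Icc 0 T)) {W : (s : ℝ) → TangentSpace 𝓘(ℝ, E) (c s)}
    {lam : ℝ → ℝ} (hW : ∀ t ∈ Icc 0 T, CovDerivEq X V c T W t 0)
    (hcurv : ∀ t ∈ Icc 0 T, CurvatureEq m X V (c t) (W t) (lam t • W t)) {y y' : ℝ → ℝ}
    (hy : ∀ t ∈ Icc 0 T, HasDerivWithinAt y (y' t) (Icc 0 T) t ∧
      HasDerivWithinAt y' (-lam t * y t) (Icc 0 T) t) :
    ∃ U : (s : ℝ) → TangentSpace 𝓘(ℝ, E) (c s),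
      IsLieParallel X c T (fun s => y' s • W s - y s • U s) := by
  choose! Y hY _ using fun t ht => (hW t ht).2
  refine ⟨fun s => ad X (Y s) (c s), fun t ht => ?_⟩
  have hX := hreg.smooth (c t)
  have hYt := hY t ht
  have hsm := hYt.1.1
  have hev : ∀ᶠ s in 𝓝[Icc 0 T] t, s ∈ Icc 0 T ∧ c s ∈ (extChartAt 𝓘(ℝ, E) (c t)).source ∧
      SmoothNear X (c s) ∧ SmoothNear (Y t) (c s) ∧ Extends V c T W s (Y t) := by
    filter_upwards [self_mem_nhdsWithin, hYt.eventually hc ht,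
      IsMIntegralCurveOn.eventually_along hc ht (extChartAt_source_mem_nhds (I := 𝓘(ℝ, E)) (c t)),
      IsMIntegralCurveOn.eventually_along hc ht hX.eventually] with s h1 h2 h3 h4
    exact ⟨h1, h3, h4, h2.1.1, h2⟩
  have hJ : ∀ᶠ s in 𝓝[Icc 0 T] t,
      chartVec (c t) (c s) (y' s • W s - y s • ad X (Y s) (c s))
      = y' s • chartField (c t) (Y t) (extChartAt 𝓘(ℝ, E) (c t) (c s))
        - y s • chartField (c t) (ad X (Y t)) (extChartAt 𝓘(ℝ, E) (c t) (c s)) := by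
    filter_upwards [hev] with s hs
    obtain ⟨h1, h2, h3, h4, h5⟩ := hs
    rw [chartField_apply _ h2, chartField_apply _ h2, hreg.ad_congr_along hT hc h1 (hY s h1) h5,
      map_sub, map_smul, map_smul, h5.2.self_of_nhdsWithin h1]
  filter_upwards [hev, eventually_eventually_nhdsWithin.2 hJ] with s hs hJs
  obtain ⟨h1, h2, h3, h4, h5⟩ := hs
  set z := extChartAt 𝓘(ℝ, E) (c t) (c s) with hz
  -- In a chart [X, Z] = DZ·X - DX·Z, so dZ/ds = [X, Z] + DX·Z along the curve. Applied to Y and [X,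
  -- Y], the bracket terms of y'Y - y[X, Y] cancel.
  have hder : ∀ {Z : VField E M}, SmoothNear Z (c s) →
      HasDerivWithinAt (fun u => chartField (c t) Z (extChartAt 𝓘(ℝ, E) (c t) (c u)))
        (chartField (c t) (ad X Z) z + fderiv ℝ (chartField (c t) X) z (chartField (c t) Z z))
        (Icc 0 T) s := fun {Z} hZ => by
    have h6 := ((contDiffAt_chartField h2 hZ.self_of_nhds).differentiableAt
      (by simp)).hasFDerivAt.comp_hasDerivWithinAt s
      (hasDerivWithinAt_chart_integralCurve hc h1 h2)
    refine h6.congr_deriv ?_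
    rw [chartField_ad h2 h3 hZ, VectorField.lieBracket]
    exact (sub_add_cancel _ _).symm
  have hW2 : chartField (c t) (ad X (ad X (Y t))) z = -lam s • chartField (c t) (Y t) z := by
    rw [hz, chartField_apply _ h2, chartField_apply _ h2,
      hreg.ad_ad_eq_neg_smul hT hc hW hcurv h1 h5, h5.2.self_of_nhdsWithin h1, map_neg, map_smul,
      neg_smul]
  have hmain := ((hy s h1).2.smul (hder h4)).sub ((hy s h1).1.smul (hder (h3.ad h4)))
  rw [hJs.self_of_nhdsWithin h1]
  refine (hmain.congr_of_eventuallyEq hJs (hJs.self_of_nhdsWithin h1)).congr_deriv ?_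
  rw [hW2, map_sub, map_smul, map_smul]
  module

/-- The flow of `X` maps `y' 0 • W 0` to `y' t • W t` at a zero `t` of `y`. -/
lemma IsRegular.exists_mem_conjugateSpace [T2Space M] (hreg : IsRegular m X V) (hT : 0 < T)
    (hc : IsMIntegralCurveOn c X (Icc 0 T)) {W : (s : ℝ) → TangentSpace 𝓘(ℝ, E) (c s)}
    {lam : ℝ → ℝ} (hW0 : ∀ t ∈ Icc 0 T, W t ≠ 0)
    (hW : ∀ t ∈ Icc 0 T, CovDerivEq X V c T W t 0)
    (hcurv : ∀ t ∈ Icc 0 T, CurvatureEq m X V (c t) (W t) (lam t • W t)) {y : ℝ → ℝ}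
    (hy : IsScalarSolution lam T y) {t : ℝ} (ht : t ∈ Icc 0 T) (hyt : y t = 0) :
    ∃ r : ℝ, r ≠ 0 ∧
      (show TangentSpace 𝓘(ℝ, E) (flowMap X t (c 0)) from (r • W t : TangentSpace 𝓘(ℝ, E) (c t)))
        ∈ conjugateSpace X V (c 0) t := by
  obtain ⟨y', hyy', hy0, hy'0⟩ := hy
  obtain ⟨U, hU⟩ := hreg.exists_isLieParallel hT hc hW hcurv hyy'
  obtain ⟨A, hA, hAJ⟩ := exists_hasMFDerivAt_flowMap_of_isLieParallel hreg.smooth hc hU ht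
  have hlam := hreg.continuousOn_eigenvalue hT hc hW0 hW hcurv
  have hmem : ∀ s ∈ Icc 0 T, ∀ r : ℝ, r • W s ∈ V (c s) := fun s hs r => by
    obtain ⟨-, Y, hY, -⟩ := hW s hs
    rw [← hY.2.self_of_nhdsWithin hs]
    exact Submodule.smul_mem _ _ hY.1.2.self_of_nhds
  have hflow : flowMap X t (c 0) = c t :=
    flowMap_eq hreg.smooth ht.1 ⟨c, hc.mono (Icc_subset_Icc_right ht.2), rfl, rfl⟩
  have hT0 : (0 : ℝ) ∈ Icc 0 T := ⟨le_rfl, hT.le⟩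
  refine ⟨y' t, scalarSolution_deriv_ne_zero hlam hyy' hy'0 ht hyt, ⟨?_, ?_⟩⟩
  · refine ⟨y' 0 • W 0, hmem 0 hT0 _, ?_⟩
    rw [hA.mfderiv]
    simp only [hy0, hyt, zero_smul, sub_zero] at hAJ
    exact hAJ
  -- The points `flowMap X t (c 0)` and `c t` are equal only propositionally, so membership is moved
  -- through `E`.
  · have transfer : ∀ {x x' : M} (_ : x = x') (v : E), (show TangentSpace 𝓘(ℝ, E) x' from v) ∈ V x' →
        (show TangentSpace 𝓘(ℝ, E) x from v) ∈ V x := by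
      rintro x _ rfl v hv
      exact hv
    exact transfer hflow _ (hmem t ht _)

end Transport

end DynamicPair

end

/-! ### The theorem. -/

theorem theorem3
    {E : Type*} [NormedAddCommGroup E] [NormedSpace ℝ E] [FiniteDimensional ℝ E]
    {M : Type*} [TopologicalSpace M] [T2Space M] [ChartedSpace E M] [IsManifold 𝓘(ℝ, E) ∞ M]
    (m : ℕ) (X : DynamicPair.VField E M) (V : DynamicPair.Planes E M)
    (hreg : DynamicPair.IsRegular m X V)
    (T : ℝ) (hT : 0 < T) (c : ℝ → M) (hc : IsMIntegralCurveOn c X (Set.Icc 0 T))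
    (r : ℕ) (L : Fin r → (t : ℝ) → Submodule ℝ (TangentSpace 𝓘(ℝ, E) (c t)))
    (lam : Fin r → ℝ → ℝ)
    (hL : ∀ i, DynamicPair.IsParallelLine X V c T (L i))
    (hindep : ∀ t ∈ Set.Icc 0 T, iSupIndep fun i => L i t)
    (heig : ∀ i, ∀ t ∈ Set.Icc 0 T, ∀ v ∈ L i t,
      DynamicPair.CurvatureEq m X V (c t) v (lam i t • v)) :
    (∀ i (κ : ℝ), 0 < κ → (∀ t ∈ Set.Ioc 0 T, κ ≤ lam i t) → Real.pi / √κ ≤ T →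
      ∃ t ∈ Set.Ioc 0 (Real.pi / √κ), DynamicPair.IsConjugateTime X V (c 0) T t) ∧
    (∀ i (y : ℝ → ℝ), DynamicPair.IsScalarSolution (lam i) T y →
      ∀ t ∈ Set.Ioc 0 T, y t = 0 → DynamicPair.IsConjugateTime X V (c 0) T t) ∧
    (∀ (S : Finset (Fin r)) (y : Fin r → ℝ → ℝ),
      (∀ i ∈ S, DynamicPair.IsScalarSolution (lam i) T (y i)) →
      ∀ t ∈ Set.Ioc 0 T, (∀ i ∈ S, y i t = 0) →
        S.card ≤ DynamicPair.multiplicity X V (c 0) t) := by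
  choose W hW using hL
  have hW0 : ∀ i, ∀ t ∈ Set.Icc 0 T, W i t ≠ 0 := fun i t ht => (hW i t ht).1
  have hWL : ∀ i, ∀ t ∈ Set.Icc 0 T, W i t ∈ L i t := fun i t ht => by
    rw [(hW i t ht).2.1]; exact Submodule.mem_span_singleton_self _
  have hWp : ∀ i, ∀ t ∈ Set.Icc 0 T, DynamicPair.CovDerivEq X V c T (W i) t 0 :=
    fun i t ht => (hW i t ht).2.2
  have hcurv : ∀ i, ∀ t ∈ Set.Icc 0 T,
      DynamicPair.CurvatureEq m X V (c t) (W i t) (lam i t • W i t) :=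
    fun i t ht => heig i t ht _ (hWL i t ht)
  have hzero : ∀ i (y : ℝ → ℝ), DynamicPair.IsScalarSolution (lam i) T y →
      ∀ t ∈ Set.Ioc 0 T, y t = 0 → DynamicPair.IsConjugateTime X V (c 0) T t := by
    intro i y hy t ht hyt
    have ht' := Set.Ioc_subset_Icc_self ht
    obtain ⟨a, ha, hmem⟩ := hreg.exists_mem_conjugateSpace hT hc (hW0 i) (hWp i) (hcurv i) hy
      ht' hyt
    refine ⟨ht, fun hbot => ?_⟩
    rw [hbot] at hmem
    have : a • W i t = 0 := (Submodule.mem_bot ℝ).1 hmem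
    exact (smul_ne_zero ha (hW0 i t ht')) this
  refine ⟨fun i κ hκ hlam hπ => ?_, hzero, fun S y hy t ht hyt => ?_⟩
  · obtain ⟨y, y', hyy', hy0, hy1⟩ := DynamicPair.exists_scalarSolution hT.le
      (hreg.continuousOn_eigenvalue hT hc (hW0 i) (hWp i) (hcurv i))
    obtain ⟨t, ht, hyt⟩ := DynamicPair.exists_zero_of_le hκ hyy' hy0 hy1 hlam hπ
    exact ⟨t, ht, hzero i y ⟨y', hyy', hy0, by rw [hy1]; exact one_ne_zero⟩ t
      ⟨ht.1, ht.2.trans hπ⟩ hyt⟩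
  · have ht' := Set.Ioc_subset_Icc_self ht
    choose a ha hmem using fun i : S => hreg.exists_mem_conjugateSpace hT hc (hW0 i) (hWp i)
      (hcurv i) (hy i i.2) ht' (hyt i i.2)
    -- Nonzero vectors from independent lines, all lying in the conjugate space.
    have hli : LinearIndependent ℝ fun i : S => a i • W i t :=
      ((hindep t ht').comp Subtype.val_injective).linearIndependent _
        (fun i => Submodule.smul_mem _ _ (hWL i t ht'))
        (fun i => smul_ne_zero (ha i) (hW0 i t ht'))
    have : FiniteDimensional ℝ (TangentSpace 𝓘(ℝ, E) (DynamicPair.flowMap X t (c 0))) :=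
      inferInstanceAs (FiniteDimensional ℝ E)
    have hli' : LinearIndependent ℝ
        fun i : S => (⟨_, hmem i⟩ : DynamicPair.conjugateSpace X V (c 0) t) :=
      LinearIndependent.of_comp (DynamicPair.conjugateSpace X V (c 0) t).subtype hli
    have hcard := hli'.fintype_card_le_finrank
    rwa [Fintype.card_coe] at hcard
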